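/- **Setting.** Let $\ell,n_c,n_v\ge 0$ be integers and $\mathbf x_{g,u}\in\mathbb F_2^\ell$ for $g\in[n_c]=\{0,\dots,n_c-1\}$, $u\in[n_v]=\{0,\dots,n_v-1\}$. For $\mathbf x\in\mathbb F_2^\ell$ let $P_{\mathbf x}$ be the $2^\ell\times2^\ell$ dyadic permutation matrix, with rows and columns indexed by $\mathbb F_2^\ell$, whose $(\mathbf a,\mathbf b)$ entry is $1$ if $\mathbf a+\mathbf b=\mathbf x$ and $0$ otherwise. Let $H=(P_{\mathbf x_{g,u}})$ be the quasi-dyadic matrix with $n_c\times n_v$ such blocks, and let its Tanner graph be the bipartite graph with biadjacency matrix $H$. It projects naturally onto the protograph, the complete bipartite graph between the block rows $[n_c]$ and the block columns $[n_v]$. Cycles are counted as subgraphs (no base point, no direction); $\mathcal N_8$ is the number of $8$-cycles of the Tanner graph. A TBC walk is a closed walk in which cyclically consecutive edges differ; closed walks are equivalent if they agree up to change of base point and direction. For rows $a,b,c,d$ and columns $u,v,v',u'$ let $[a,b,b,c,c,d,d,a]_{u,v,v',u'}$ be the closed walk $a,u,b,v,c,v',d,u',a$ of length $8$ in the protograph.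 For rows $h<i<j<k$ the 21 patterns, written as $abcd$, are, for $m=1,\dots,21$ in this order: $$hihi,\ hihj,\ hihk,\ hjhj,\ hjhk,\ hkhk,\ hjij,\ hjik,\ hkik,\ hiji,\ hijk,\ hkjk,\ hiki,\ hikj,\ hjkj,\ ijij,\ ijik,\ ikik,\ ikjk,\ ijkj,\ jkjk .$$ If $n_c<4$, the same list is used with row numbers $h<i<j<k$ in $\mathbb N$, and patterns that involve a row number $\ge n_c$ are omitted. To a pattern $s=abcd$ belong the multisets $$A_{s,1}=\{(u,v,\mathbf x_{a,u}+\mathbf x_{b,u}+\mathbf x_{b,v}+\mathbf x_{c,v})\mid u\ne v\},\qquad A_{s,2}=\{(u,v,\mathbf x_{a,u}+\mathbf x_{d,u}+\mathbf x_{d,v}+\mathbf x_{c,v})\mid u\ne v\}.$$ A repetition is a pair $(u,v,\boldsymbol\alpha)\in A_{s,1}$, $(u',v',\boldsymbol\alpha')\in A_{s,2}$ with $\boldsymbol\alpha=\boldsymbol\alpha'$, $u\ne u'$, $v\ne v'$. Let $\mathcal R_s$ be the number of repetitions, $\mathcal R_s^{*c}$ and $\mathcal R_s^{*nc}$ the numbers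 of those that do, respectively do not, satisfy both $u=v'$ and $v=u'$, and $$\mathcal R_s^*=\tfrac{2^\ell}{2}\cdot\tfrac12\,\mathcal R_s^{*c}+2^\ell\cdot\tfrac14\,\mathcal R_s^{*nc}=\tfrac{2^\ell}{4}\left(\mathcal R_s^{*c}+\mathcal R_s^{*nc}\right).$$ **Theorem.** 1. For fixed $h<i<j<k$, walks of two different patterns among the 21 are never equivalent, whatever their columns. 2. The check nodes of every $8$-cycle of the Tanner graph lie in block rows among some $h<i<j<k$ (which can be chosen in $[n_c]$ if $n_c\ge4$). For every such choice of $h<i<j<k$ the cycle projects onto a walk equivalent to $[a,b,b,c,c,d,d,a]_{u,v,v',u'}$ for one of the 21 patterns $abcd$ and columns given by a repetition of that pattern. Assume from now on that the girth $g$ of the Tanner graph satisfies $8<2g$ ($g=\infty$ if there is no cycle). 3. For every repetition in any of the 21 pairs, $W=[a,b,b,c,c,d,d,a]_{u,v,v',u'}$ is a TBC walk, for every vertex over its base point $W$ lifts to an $8$-cycle through that vertex, and the number of $8$-cycles that project onto a walk equivalent to $W$ is $2^\ell/2$ if $a=c$, $b=d$, $u=v'$, $v=u'$, and $2^\ell$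 otherwise. 4. Counting every nonequivalent pattern once, $$\mathcal N_8=\sum_{h<i}\mathcal R^*_{hihi}+\sum_{h<i<j}\frac{2^\ell}{2}\left(\mathcal R_{hihj}+\mathcal R_{hjij}+\mathcal R_{hiji}\right)+\sum_{h<i<j<k}2^\ell\left(\mathcal R_{hjik}+\mathcal R_{hijk}+\mathcal R_{hikj}\right),$$ the sums being over rows in $[n_c]$. 5. If $n_c\ge4$, then, with $T_m=\mathcal R^*_s$ for $m\in\{1,4,6,16,18,21\}$, $T_m=2^\ell\mathcal R_s$ for $m\in\{8,11,14\}$ and $T_m=\frac{2^\ell}{2}\mathcal R_s$ for the other $m$, where $s$ is the $m$-th pattern for $h<i<j<k$, and with $d_m$ the number of distinct rows in pattern $m$, $$\mathcal N_8=\sum_{\substack{h,i,j,k\in[n_c]\\h<i<j<k}}\ \sum_{m=1}^{21}\binom{n_c-d_m}{4-d_m}^{-1}T_m .$$ In particular, for $n_c=4$, $\mathcal N_8$ is the plain sum $\sum_{m=1}^{21}T_m$. -/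

import Mathlib

open Finset

namespace QuasiDyadic

/-- The index group `𝔽₂^ℓ` of the rows and columns of `2^ℓ × 2^ℓ` dyadic matrices. -/
abbrev F2 (ℓ : ℕ) : Type := Fin ℓ → ZMod 2

/-- The dyadic matrix with signature (first row) `v`: `D a b = D 0 (a + b) = v (a + b)`. -/
def dyadic {ℓ : ℕ} (v : F2 ℓ → ZMod 2) : Matrix (F2 ℓ) (F2 ℓ) (ZMod 2) :=
  Matrix.of fun a b => v (a + b)

/-- The dyadic permutation matrix `P_x`: its signature has a single `1`, in position `x`. -/
def dyadicPerm {ℓ : ℕ} (x : F2 ℓ) : Matrix (F2 ℓ) (F2 ℓ) (ZMod 2) :=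
  dyadic (Pi.single x 1)

/-- The quasi-dyadic parity-check matrix `H = (P_{x i u})`, with `nc × nv` blocks. -/
def parityCheck {ℓ nc nv : ℕ} (x : Fin nc → Fin nv → F2 ℓ) :
    Matrix (Fin nc × F2 ℓ) (Fin nv × F2 ℓ) (ZMod 2) :=
  Matrix.of fun p q => dyadicPerm (x p.1 q.1) p.2 q.2

/-- The Tanner graph of a binary matrix: the bipartite graph of which it is the biadjacency
matrix. The left summand holds the check nodes, the right one the variable nodes. -/
def tannerGraph {R C : Type*} (H : Matrix R C (ZMod 2)) : SimpleGraph (R ⊕ C) where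
  Adj
    | Sum.inl r, Sum.inr c => H r c ≠ 0
    | Sum.inr c, Sum.inl r => H r c ≠ 0
    | _, _ => False
  symm := ⟨by rintro (a | a) (b | b) h <;> exact h⟩
  loopless := ⟨by rintro (a | a) h <;> exact h⟩

/-- The protograph of `parityCheck x`: its base matrix is the all-ones `nc × nv` matrix. -/
abbrev protograph (nc nv : ℕ) : SimpleGraph (Fin nc ⊕ Fin nv) :=
  completeBipartiteGraph (Fin nc) (Fin nv)

/-- The natural projection of the Tanner graph onto the protograph. -/
def projection {ℓ nc nv : ℕ} (x : Fin nc → Fin nv → F2 ℓ) :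
    tannerGraph (parityCheck x) →g protograph nc nv where
  toFun := Sum.map Prod.fst Prod.fst
  map_rel' := by
    rintro (a | a) (b | b) h
    · exact h.elim
    · simp
    · simp
    · exact h.elim

section Walks

variable {V : Type*} {G : SimpleGraph V}

/-- A tailless backtrackless closed walk: consecutive edges differ, also cyclically. -/
def IsTBC {a : V} (p : G.Walk a a) : Prop :=
  p.edges.IsChain (· ≠ ·) ∧ p.edges.getLast? ≠ p.edges.head?

/-- Equivalence of closed walks: equality up to a change of base point, a change of direction,
or both. -/
def ClosedEquiv {a b : V} (p : G.Walk a a) (q : G.Walk b b) : Prop :=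
  p.darts.IsRotated q.darts ∨ p.darts.IsRotated q.reverse.darts

/-- The `n`-cycles of a graph without base point and direction, each given by its edge set. -/
def cycleSet (G : SimpleGraph V) (n : ℕ) : Set (Set (Sym2 V)) :=
  {S | ∃ (a : V) (p : G.Walk a a), p.IsCycle ∧ p.length = n ∧ S = {e | e ∈ p.edges}}

end Walks

/-- The number of 8-cycles in the Tanner graph of `parityCheck x`. -/
noncomputable def numEightCycles {ℓ nc nv : ℕ} (x : Fin nc → Fin nv → F2 ℓ) : ℕ :=
  (cycleSet (tannerGraph (parityCheck x)) 8).ncard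

/-- The 8-cycles of the Tanner graph that project onto a closed walk equivalent to `W`. -/
def eightCyclesOver {ℓ nc nv : ℕ} (x : Fin nc → Fin nv → F2 ℓ) {b : Fin nc ⊕ Fin nv}
    (W : (protograph nc nv).Walk b b) : Set (Set (Sym2 ((Fin nc × F2 ℓ) ⊕ (Fin nv × F2 ℓ)))) :=
  {S | ∃ (a : _) (p : (tannerGraph (parityCheck x)).Walk a a), p.IsCycle ∧ p.length = 8 ∧
    S = {e | e ∈ p.edges} ∧ ClosedEquiv (p.map (projection x)) W}

/-- The closed walk of length 8 in the protograph that visits in this order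
`s 0, c 0, s 1, c 1, s 2, c 2, s 3, c 3, s 0`, where `s` lists rows and `c` columns. In terms of
the blocks it traverses, it is `[s₀, s₁, s₁, s₂, s₂, s₃, s₃, s₀]` at columns `c₀, c₁, c₂, c₃`. -/
def rowColWalk {nc nv : ℕ} (s : Fin 4 → Fin nc) (c : Fin 4 → Fin nv) :
    (protograph nc nv).Walk (Sum.inl (s 0)) (Sum.inl (s 0)) :=
  .cons (v := Sum.inr (c 0)) (by simp) <| .cons (v := Sum.inl (s 1)) (by simp) <|
  .cons (v := Sum.inr (c 1)) (by simp) <| .cons (v := Sum.inl (s 2)) (by simp) <|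
  .cons (v := Sum.inr (c 2)) (by simp) <| .cons (v := Sum.inl (s 3)) (by simp) <|
  .cons (v := Sum.inr (c 3)) (by simp) <| .cons (v := Sum.inl (s 0)) (by simp) .nil

/-- The 21 walk patterns. Rows `h < i < j < k` are coded as `0, 1, 2, 3`; the entry `![a, b, c, d]`
is the pattern `[a, b, b, c, c, d, d, a]`. The index `m : Fin 21` is the pattern number minus 1. -/
def pattern : Fin 21 → Fin 4 → Fin 4 :=
  ![![0, 1, 0, 1], ![0, 1, 0, 2], ![0, 1, 0, 3], ![0, 2, 0, 2], ![0, 2, 0, 3], ![0, 3, 0, 3],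
    ![0, 2, 1, 2], ![0, 2, 1, 3], ![0, 3, 1, 3], ![0, 1, 2, 1], ![0, 1, 2, 3], ![0, 3, 2, 3],
    ![0, 1, 3, 1], ![0, 1, 3, 2], ![0, 2, 3, 2], ![1, 2, 1, 2], ![1, 2, 1, 3], ![1, 3, 1, 3],
    ![1, 3, 2, 3], ![1, 2, 3, 2], ![2, 3, 2, 3]]

/-- `s` is the row sequence of pattern `m` for the row numbers `r 0 < r 1 < r 2 < r 3`. Only the
rows that occur in the pattern have to be rows of `H`, so that for `nc < 4` the patterns with
missing rows are omitted. -/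
def IsPatternRows {nc : ℕ} (m : Fin 21) (r : Fin 4 → ℕ) (s : Fin 4 → Fin nc) : Prop :=
  StrictMono r ∧ ∀ t, (s t : ℕ) = r (pattern m t)

section Counting

variable {ℓ nc nv : ℕ}

/-- The multiset `{(u, v, a_u + b_u + b_v + c_v) | u ≠ v}` for rows `a, b, c`. -/
def shiftMultiset (x : Fin nc → Fin nv → F2 ℓ) (a b c : Fin nc) :
    Multiset (Fin nv × Fin nv × F2 ℓ) :=
  (univ.filter fun q : Fin nv × Fin nv => q.1 ≠ q.2).val.map
    fun q => (q.1, q.2, x a q.1 + x b q.1 + x b q.2 + x c q.2)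

/-- First multiset of the pattern with row sequence `s`. -/
def A₁ (x : Fin nc → Fin nv → F2 ℓ) (s : Fin 4 → Fin nc) : Multiset (Fin nv × Fin nv × F2 ℓ) :=
  shiftMultiset x (s 0) (s 1) (s 2)

/-- Second multiset of the pattern with row sequence `s`. -/
def A₂ (x : Fin nc → Fin nv → F2 ℓ) (s : Fin 4 → Fin nc) : Multiset (Fin nv × Fin nv × F2 ℓ) :=
  shiftMultiset x (s 0) (s 3) (s 2)

/-- The repetitions between `X` and `Y`: pairs of `(u, v, α) ∈ X` and `(u', v', α') ∈ Y` with
`α = α'`, `u ≠ u'` and `v ≠ v'`. -/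
def repetitions (X Y : Multiset (Fin nv × Fin nv × F2 ℓ)) :
    Multiset ((Fin nv × Fin nv × F2 ℓ) × (Fin nv × Fin nv × F2 ℓ)) :=
  (X ×ˢ Y).filter fun p => p.1.2.2 = p.2.2.2 ∧ p.1.1 ≠ p.2.1 ∧ p.1.2.1 ≠ p.2.2.1

/-- The number of repetitions between the two multisets of the row sequence `s`. -/
def numRep (x : Fin nc → Fin nv → F2 ℓ) (s : Fin 4 → Fin nc) : ℕ :=
  (repetitions (A₁ x s) (A₂ x s)).card

/-- The number of repetitions with `u = v'` and `v = u'`. -/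
def numRepC (x : Fin nc → Fin nv → F2 ℓ) (s : Fin 4 → Fin nc) : ℕ :=
  ((repetitions (A₁ x s) (A₂ x s)).filter fun p => p.1.1 = p.2.2.1 ∧ p.1.2.1 = p.2.1).card

/-- The number of repetitions that do not satisfy `u = v'` and `v = u'`. -/
def numRepNC (x : Fin nc → Fin nv → F2 ℓ) (s : Fin 4 → Fin nc) : ℕ :=
  ((repetitions (A₁ x s) (A₂ x s)).filter fun p => ¬ (p.1.1 = p.2.2.1 ∧ p.1.2.1 = p.2.1)).card

/-- The starred count `2^ℓ/2 · 1/2 · R^{*c} + 2^ℓ · 1/4 · R^{*nc}`. -/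
def starCount (x : Fin nc → Fin nv → F2 ℓ) (s : Fin 4 → Fin nc) : ℚ :=
  2 ^ ℓ / 2 * (1 / 2) * numRepC x s + 2 ^ ℓ * (1 / 4) * numRepNC x s

/-- The summand of pattern number `m + 1` with row sequence `s`: the starred count for the patterns
1, 4, 6, 16, 18, 21, the weight `2^ℓ` for the patterns 8, 11, 14, and `2^ℓ/2` for the others. -/
def patternTerm (x : Fin nc → Fin nv → F2 ℓ) (m : Fin 21) (s : Fin 4 → Fin nc) : ℚ :=
  if m ∈ ({0, 3, 5, 15, 17, 20} : Finset (Fin 21)) then starCount x s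
  else if m ∈ ({7, 10, 13} : Finset (Fin 21)) then 2 ^ ℓ * numRep x s
  else 2 ^ ℓ / 2 * numRep x s

/-- The number of distinct rows in pattern `m`. -/
def numRows (m : Fin 21) : ℕ := (univ.image (pattern m)).card

end Counting

end QuasiDyadic

/-! An 8-cycle has exactly eight traversals that start at a check node: four base points, two
directions (`numEightCycles_mul_eight`). Traversals are stored as four check nodes and four variable
nodes; the dihedral group, indexed by `Bool × Fin 4`, acts on them through `rowIdx` and `colIdx`.

Every block is a permutation matrix. So a traversal is determined by its rows `s`, its columns `c`
and the shift of its first check node, and `(s, c)` lifts to closed walks iff its shifts sum to zero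
(`eq_lift_of_isOctagon`, `isOctagon_lift`). If consecutive rows and columns differ, so do
consecutive nodes of the lift; a coincidence of opposite nodes would give a 4-cycle, which `8 < 2 g`
excludes (`injective_of_proper`). Hence there are `2 ^ ℓ` traversals for each such `(s, c)` with
zero sum (`ncard_octagons`), and for fixed `s` these `c` are the repetitions
(`numRep_eq_card_liftCols`).

A proper row sequence is an increasing choice of 2, 3 or 4 rows followed by a surjective word. The
words form dihedral orbits of size 2, 4 or 8, on which the number of repetitions is constant;
division by 8 gives the weights 1/4, 1/2 and 1. The 21 patterns represent all orbits of proper words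
on four letters. The last formula counts each set of `d` rows once for every quadruple that contains
it and divides by the number of these.

Over a fixed walk, two of the `2 ^ ℓ` lifts trace the same cycle only through a symmetry of `(s,
c)`, and the only nontrivial one possible is the half turn (`eq_zero_or_two_of_symmetry`). -/

namespace QuasiDyadic

/-! ### Closed walks of length 8 in bipartite graphs and their dihedral symmetries -/

section Octagon

variable {R C R' C' : Type*}

/-- The rows of a closed walk of length 8 after a change of base point and direction: `e.2` is the
index of the new base point, `e.1` tells whether the direction is reversed. -/
def rowIdx (e : Bool × Fin 4) (t : Fin 4) : Fin 4 := if e.1 then e.2 - t else e.2 + t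

/-- The columns of a closed walk of length 8 after a change of base point and direction. -/
def colIdx (e : Bool × Fin 4) (t : Fin 4) : Fin 4 := if e.1 then e.2 - t - 1 else e.2 + t

/-- Cyclically consecutive entries differ. -/
def Proper {α : Type*} (f : Fin 4 → α) : Prop := ∀ t, f t ≠ f (t + 1)

instance {α : Type*} [DecidableEq α] (f : Fin 4 → α) : Decidable (Proper f) :=
  inferInstanceAs (Decidable (∀ t, f t ≠ f (t + 1)))

lemma Proper.of_injective {α : Type*} {f : Fin 4 → α} (hf : Function.Injective f) : Proper f :=
  fun t h => by simpa using hf h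

lemma proper_comp_colIdx {α : Type*} {f : Fin 4 → α} (hf : Proper f) (e : Bool × Fin 4) :
    Proper (f ∘ colIdx e) := by
  obtain ⟨_ | _, j⟩ := e <;> intro t
  · simpa [colIdx, add_assoc] using hf (j + t)
  · have := hf (j - (t + 1) - 1)
    rw [show j - (t + 1) - 1 + 1 = j - t - 1 by abel] at this
    simpa [colIdx] using this.symm

lemma rowIdx_injective : ∀ e, Function.Injective (rowIdx e) := by decide

lemma colIdx_injective : ∀ e, Function.Injective (colIdx e) := by decide

/-- The vertices `k 0, v 0, k 1, v 1, k 2, v 2, k 3, v 3, k 0` form a closed walk. -/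
def IsOctagon (G : SimpleGraph (R ⊕ C)) (k : Fin 4 → R) (v : Fin 4 → C) : Prop :=
  ∀ t, G.Adj (Sum.inl (k t)) (Sum.inr (v t)) ∧ G.Adj (Sum.inr (v t)) (Sum.inl (k (t + 1)))

/-- The closed walk through `k 0, v 0, k 1, v 1, k 2, v 2, k 3, v 3, k 0`. -/
def octWalk {G : SimpleGraph (R ⊕ C)} (k : Fin 4 → R) (v : Fin 4 → C) (h : IsOctagon G k v) :
    G.Walk (Sum.inl (k 0)) (Sum.inl (k 0)) :=
  .cons (h 0).1 <| .cons (h 0).2 <| .cons (h 1).1 <| .cons (h 1).2 <|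
  .cons (h 2).1 <| .cons (h 2).2 <| .cons (h 3).1 <| .cons (h 3).2 .nil

/-- The edges of the closed walk through `k 0, v 0, k 1, v 1, k 2, v 2, k 3, v 3, k 0`. -/
def octEdges (k : Fin 4 → R) (v : Fin 4 → C) : Set (Sym2 (R ⊕ C)) :=
  {z | ∃ t, z = s(Sum.inl (k t), Sum.inr (v t)) ∨ z = s(Sum.inl (k (t + 1)), Sum.inr (v t))}

variable {G : SimpleGraph (R ⊕ C)} {k k' : Fin 4 → R} {v v' : Fin 4 → C}

lemma octWalk_edges (h : IsOctagon G k v) : {e | e ∈ (octWalk k v h).edges} = octEdges k v := by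
  ext z
  simp [octWalk, octEdges, Fin.exists_fin_succ, or_assoc,
    Sym2.eq_swap (a := Sum.inr _) (b := Sum.inl _)]

/-- Column `t` lies between rows `t` and `t + 1`; reversal therefore takes rows to `j - t` but
columns to `j - t - 1`. -/
lemma IsOctagon.comp (h : IsOctagon G k v) (e : Bool × Fin 4) :
    IsOctagon G (k ∘ rowIdx e) (v ∘ colIdx e) := by
  obtain ⟨_ | _, j⟩ := e <;> intro t
  · simpa [rowIdx, colIdx, add_assoc] using h (j + t)
  · have h1 := h (j - t - 1)
    rw [sub_add_cancel] at h1
    exact ⟨by simpa [rowIdx, colIdx] using h1.2.symm,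
      by simpa [rowIdx, colIdx, sub_add_eq_sub_sub] using h1.1.symm⟩

lemma octWalk_isCycle (h : IsOctagon G k v) (hk : Function.Injective k)
    (hv : Function.Injective v) : (octWalk k v h).IsCycle := by
  unfold octWalk
  rw [SimpleGraph.Walk.cons_isCycle_iff]
  simp [SimpleGraph.Walk.isPath_def, hk.eq_iff, hv.eq_iff]

lemma closedEquiv_comp (h : IsOctagon G k v) (e : Bool × Fin 4) :
    ClosedEquiv (octWalk k v h) (octWalk _ _ (h.comp e)) := by
  obtain ⟨_ | _, j⟩ := e
  · left; fin_cases j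
    exacts [⟨0, rfl⟩, ⟨2, rfl⟩, ⟨4, rfl⟩, ⟨6, rfl⟩]
  · right; fin_cases j
    exacts [⟨0, rfl⟩, ⟨2, rfl⟩, ⟨4, rfl⟩, ⟨6, rfl⟩]

lemma exists_of_isRotated
    (h : [Sum.inl (k 0), Sum.inr (v 0), Sum.inl (k 1), Sum.inr (v 1), Sum.inl (k 2),
      Sum.inr (v 2), Sum.inl (k 3), Sum.inr (v 3)].IsRotated [Sum.inl (k' 0), Sum.inr (v' 0),
      Sum.inl (k' 1), Sum.inr (v' 1), Sum.inl (k' 2), Sum.inr (v' 2), Sum.inl (k' 3),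
      Sum.inr (v' 3)]) :
    ∃ j, k' = k ∘ rowIdx (false, j) ∧ v' = v ∘ colIdx (false, j) := by
  rw [List.isRotated_iff_mod] at h
  obtain ⟨n, hn, h⟩ := h
  simp only [List.length_cons, List.length_nil, zero_add, Nat.reduceAdd] at hn
  have key : ∀ j : Fin 4, (∀ t, k' t = k (j + t)) → (∀ t, v' t = v (j + t)) →
      ∃ j, k' = k ∘ rowIdx (false, j) ∧ v' = v ∘ colIdx (false, j) :=
    fun j h1 h2 => ⟨j, funext h1, funext h2⟩
  -- Odd rotations match a check with a variable and are refuted by `simp`. The full turn `n = 8`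
  -- remains beside `n = 0`, so `key 0` occurs twice.
  interval_cases n <;> simp at h
  · exact key 0 (by simp [Fin.forall_fin_succ, h]) (by simp [Fin.forall_fin_succ, h])
  · exact key 1 (by simp [Fin.forall_fin_succ, h]) (by simp [Fin.forall_fin_succ, h])
  · exact key 2 (by simp [Fin.forall_fin_succ, h]) (by simp [Fin.forall_fin_succ, h])
  · exact key 3 (by simp [Fin.forall_fin_succ, h]) (by simp [Fin.forall_fin_succ, h])
  · exact key 0 (by simp [Fin.forall_fin_succ, h]) (by simp [Fin.forall_fin_succ, h])

lemma exists_of_closedEquiv {h : IsOctagon G k v} {h' : IsOctagon G k' v'}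
    (H : ClosedEquiv (octWalk k v h) (octWalk k' v' h')) :
    ∃ e, k' = k ∘ rowIdx e ∧ v' = v ∘ colIdx e := by
  obtain H | H := H
  · obtain ⟨j, hj⟩ := exists_of_isRotated (H.map (·.fst))
    exact ⟨_, hj⟩
  -- Reading the second walk backwards from `k' 0` is the index change `(true, 0)`. It is undone
  -- below by evaluating at `-t` and `-t - 1`.
  · obtain ⟨j, hk, hv⟩ := exists_of_isRotated
      (k' := k' ∘ rowIdx (true, 0)) (v' := v' ∘ colIdx (true, 0)) (H.map (·.fst))
    refine ⟨(true, j), funext fun t => ?_, funext fun t => ?_⟩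
    · simpa [rowIdx, sub_eq_add_neg] using congrFun hk (-t)
    · have := congrFun hv (-t - 1)
      simp only [colIdx, Function.comp, if_true, if_false, Bool.false_eq_true] at this ⊢
      convert this using 2 <;> abel

-- A walk on an octagon that never turns back runs around it in one of the two directions. The
-- conditions are interleaved with the quantifiers so that `decide` drops a partial walk at its
-- first violation.
set_option synthInstance.maxSize 2000 in
set_option synthInstance.maxHeartbeats 400000 in
lemma index_dihedral : ∀ a₀ b₀ : Fin 4, (b₀ = a₀ ∨ b₀ = a₀ + 1) → ∀ b₁, (b₁ = a₀ ∨ b₁ = a₀ + 1) →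
    b₁ ≠ b₀ → ∀ a₁, a₁ ≠ a₀ → (b₁ = a₁ ∨ b₁ = a₁ + 1) → ∀ b₂, (b₂ = a₁ ∨ b₂ = a₁ + 1) →
    b₂ ≠ b₁ → ∀ a₂, a₂ ≠ a₁ → (b₂ = a₂ ∨ b₂ = a₂ + 1) → ∀ b₃, (b₃ = a₂ ∨ b₃ = a₂ + 1) →
    b₃ ≠ b₂ → ∀ a₃, a₃ ≠ a₂ → (b₃ = a₃ ∨ b₃ = a₃ + 1) →
    ∃ e, ![b₀, b₁, b₂, b₃] = rowIdx e ∧ ![a₀, a₁, a₂, a₃] = colIdx e := by decide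

/-- Injectivity turns the second walk into a walk on the indices of the first that never turns back,
to which `index_dihedral` applies. -/
lemma exists_of_octEdges_eq (hk : Function.Injective k) (hv : Function.Injective v)
    (hk' : Function.Injective k') (hv' : Function.Injective v')
    (H : octEdges k' v' = octEdges k v) : ∃ e, k' = k ∘ rowIdx e ∧ v' = v ∘ colIdx e := by
  have h1 : ∀ t, ∃ a, ∃ b, (b = a ∨ b = a + 1) ∧ v' t = v a ∧ k' t = k b := by
    intro t
    obtain ⟨a, ha⟩ := H.le (show s(Sum.inl (k' t), Sum.inr (v' t)) ∈ _ from ⟨t, .inl rfl⟩)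
    simp only [Sym2.eq_iff, Sum.inl.injEq, Sum.inr.injEq, reduceCtorEq, and_false, or_false] at ha
    exact ha.elim (fun h => ⟨a, a, by simp [h]⟩) (fun h => ⟨a, a + 1, by simp [h]⟩)
  have h2 : ∀ t, ∃ a, ∃ b, (b = a ∨ b = a + 1) ∧ v' t = v a ∧ k' (t + 1) = k b := by
    intro t
    obtain ⟨a, ha⟩ := H.le (show s(Sum.inl (k' (t + 1)), Sum.inr (v' t)) ∈ _ from ⟨t, .inr rfl⟩)
    simp only [Sym2.eq_iff, Sum.inl.injEq, Sum.inr.injEq, reduceCtorEq, and_false, or_false] at ha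
    exact ha.elim (fun h => ⟨a, a, by simp [h]⟩) (fun h => ⟨a, a + 1, by simp [h]⟩)
  choose a b hab ha hb using h1
  have hab' : ∀ t, b (t + 1) = a t ∨ b (t + 1) = a t + 1 := by
    intro t
    obtain ⟨a', b', h, h', h''⟩ := h2 t
    rw [hv ((ha t).symm.trans h'), hk ((hb _).symm.trans h'')]
    exact h
  have hane : ∀ t, a (t + 1) ≠ a t := fun t h => by
    simpa using hv' ((ha _).trans ((congrArg v h).trans (ha t).symm))
  have hbne : ∀ t, b (t + 1) ≠ b t := fun t h => by
    simpa using hk' ((hb _).trans ((congrArg k h).trans (hb t).symm))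
  obtain ⟨e, he, he'⟩ := index_dihedral (a 0) (b 0) (hab 0) (b 1) (hab' 0) (hbne 0) (a 1) (hane 0)
    (hab 1) (b 2) (hab' 1) (hbne 1) (a 2) (hane 1) (hab 2) (b 3) (hab' 2) (hbne 2) (a 3) (hane 2)
    (hab 3)
  refine ⟨e, funext fun t => ?_, funext fun t => ?_⟩
  · rw [hb, Function.comp, ← he]
    fin_cases t <;> rfl
  · rw [ha, Function.comp, ← he']
    fin_cases t <;> rfl

lemma octEdges_comp (h : IsOctagon G k v) (e : Bool × Fin 4) :
    octEdges (k ∘ rowIdx e) (v ∘ colIdx e) = octEdges k v := by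
  rw [← octWalk_edges h, ← octWalk_edges (h.comp e)]
  ext z
  obtain H | H := closedEquiv_comp h e
  · exact (H.map (·.edge)).mem_iff.symm
  · refine ((H.map (·.edge)).mem_iff.trans ?_).symm
    change z ∈ (octWalk _ _ (h.comp e)).reverse.edges ↔ _
    simp

/-- The dihedral action is free on injective traversals, so every orbit has eight elements. -/
lemma comp_index_injective (hk : Function.Injective k) (hv : Function.Injective v) :
    Function.Injective fun e : Bool × Fin 4 => (k ∘ rowIdx e, v ∘ colIdx e) := by
  intro e e' h
  obtain ⟨h1, h2⟩ := Prod.mk.inj h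
  have key : ∀ e e', rowIdx e = rowIdx e' → colIdx e = colIdx e' → e = e' := by decide
  exact key e e' (hk.comp_left h1) (hv.comp_left h2)

/-- Every 8-cycle of a bipartite graph is traversed by an `octWalk`, up to the base point. -/
lemma exists_octWalk (hR : ∀ r r', ¬ G.Adj (Sum.inl r) (Sum.inl r'))
    (hC : ∀ c c', ¬ G.Adj (Sum.inr c) (Sum.inr c')) {a : R ⊕ C} (p : G.Walk a a)
    (hp : p.IsCycle) (hl : p.length = 8) :
    ∃ (k : Fin 4 → R) (v : Fin 4 → C) (h : IsOctagon G k v), Function.Injective k ∧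
      Function.Injective v ∧ p.darts.IsRotated (octWalk k v h).darts := by
  have key : ∃ (k : Fin 4 → R) (v : Fin 4 → C) (h : IsOctagon G k v),
      p.darts.IsRotated (octWalk k v h).darts := by
    clear hp
    obtain _ | ⟨h1, p⟩ := p
    · simp at hl
    obtain _ | ⟨h2, p⟩ := p
    · simp at hl
    obtain _ | ⟨h3, p⟩ := p
    · simp at hl
    obtain _ | ⟨h4, p⟩ := p
    · simp at hl
    obtain _ | ⟨h5, p⟩ := p
    · simp at hl
    obtain _ | ⟨h6, p⟩ := p
    · simp at hl
    obtain _ | ⟨h7, p⟩ := p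
    · simp at hl
    obtain _ | ⟨h8, p⟩ := p
    · simp at hl
    obtain _ | ⟨h9, p⟩ := p
    swap
    · simp at hl
    rename_i w1 w2 w3 w4 w5 w6 w7
    obtain k0 | v0 := a
    · obtain _ | v0 := w1
      · exact (hR _ _ h1).elim
      obtain k1 | _ := w2
      swap
      · exact (hC _ _ h2).elim
      obtain _ | v1 := w3
      · exact (hR _ _ h3).elim
      obtain k2 | _ := w4
      swap
      · exact (hC _ _ h4).elim
      obtain _ | v2 := w5
      · exact (hR _ _ h5).elim
      obtain k3 | _ := w6
      swap
      · exact (hC _ _ h6).elim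
      obtain _ | v3 := w7
      · exact (hR _ _ h7).elim
      have h : IsOctagon G ![k0, k1, k2, k3] ![v0, v1, v2, v3] := by
        intro t
        fin_cases t
        exacts [⟨h1, h2⟩, ⟨h3, h4⟩, ⟨h5, h6⟩, ⟨h7, h8⟩]
      exact ⟨_, _, h, 0, rfl⟩
    · obtain k0 | _ := w1
      swap
      · exact (hC _ _ h1).elim
      obtain _ | v1 := w2
      · exact (hR _ _ h2).elim
      obtain k1 | _ := w3
      swap
      · exact (hC _ _ h3).elim
      obtain _ | v2 := w4
      · exact (hR _ _ h4).elim
      obtain k2 | _ := w5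
      swap
      · exact (hC _ _ h5).elim
      obtain _ | v3 := w6
      · exact (hR _ _ h6).elim
      obtain k3 | _ := w7
      swap
      · exact (hC _ _ h7).elim
      -- The walk is based at the variable `v0`; rotated by one dart it starts at `k0`, and `v0`
      -- becomes the last column.
      have h : IsOctagon G ![k0, k1, k2, k3] ![v1, v2, v3, v0] := by
        intro t
        fin_cases t
        exacts [⟨h2, h3⟩, ⟨h4, h5⟩, ⟨h6, h7⟩, ⟨h8, h1⟩]
      exact ⟨_, _, h, 1, rfl⟩
  obtain ⟨k, v, h, hr⟩ := key
  have hn : ((octWalk k v h).darts.map (·.snd)).Nodup := by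
    rw [← (hr.map _).nodup_iff, SimpleGraph.Walk.map_snd_darts]
    exact hp.support_nodup
  have hn' : [Sum.inr (v 0), Sum.inl (k 1), Sum.inr (v 1), Sum.inl (k 2), Sum.inr (v 2),
    Sum.inl (k 3), Sum.inr (v 3), Sum.inl (k 0)].Nodup := hn
  simp at hn'
  refine ⟨k, v, h, ?_, ?_, hr⟩
  · intro s t hst
    fin_cases s <;> fin_cases t <;> simp_all
  · intro s t hst
    fin_cases s <;> fin_cases t <;> simp_all

end Octagon

/-- A map all of whose fibres on `T` have `d` elements has an image of size `#T / d`. -/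
lemma ncard_image_mul_eq {α β : Type*} (T : Finset α) (f : α → β) (d : ℕ)
    (hd : ∀ a ∈ T, {b | b ∈ T ∧ f b = f a}.ncard = d) :
    (f '' (T : Set α)).ncard * d = T.card := by
  classical
  rw [← Finset.coe_image, Set.ncard_coe_finset, Finset.card_eq_sum_card_image f T,
    Finset.sum_const_nat]
  intro b hb
  obtain ⟨a, ha, rfl⟩ := Finset.mem_image.1 hb
  rw [← hd a ha, ← Set.ncard_coe_finset]
  congr 1
  ext; simp

/-! ### Lifts of protograph walks to the Tanner graph -/

section Tanner

variable {ℓ nc nv : ℕ} {x : Fin nc → Fin nv → F2 ℓ}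

lemma F2.add_self (y : F2 ℓ) : y + y = 0 := by
  ext i
  exact CharTwo.add_self_eq_zero _

lemma F2.add_eq_iff (y z w : F2 ℓ) : y + z = w ↔ z = y + w := by
  constructor
  · rintro rfl
    rw [← add_assoc, F2.add_self, zero_add]
  · rintro rfl
    rw [← add_assoc, F2.add_self, zero_add]

lemma tanner_adj (g : Fin nc) (u : Fin nv) (y z : F2 ℓ) :
    (tannerGraph (parityCheck x)).Adj (Sum.inl (g, y)) (Sum.inr (u, z)) ↔ z = y + x g u := by
  rw [← F2.add_eq_iff]
  change Pi.single (M := fun _ => ZMod 2) (x g u) 1 (y + z) ≠ 0 ↔ _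
  simp [Pi.single_apply]

lemma tanner_adj' (g : Fin nc) (u : Fin nv) (y z : F2 ℓ) :
    (tannerGraph (parityCheck x)).Adj (Sum.inr (u, z)) (Sum.inl (g, y)) ↔ z = y + x g u := by
  rw [SimpleGraph.adj_comm, tanner_adj]

/-- The sum of the shifts along the closed walk with rows `s` and columns `c`. -/
def walkSum (x : Fin nc → Fin nv → F2 ℓ) (s : Fin 4 → Fin nc) (c : Fin 4 → Fin nv) : F2 ℓ :=
  ∑ t, (x (s t) (c t) + x (s (t + 1)) (c t))

/-- The second components of the check nodes of a lift. -/
def liftShift (x : Fin nc → Fin nv → F2 ℓ) (s : Fin 4 → Fin nc) (c : Fin 4 → Fin nv) (y : F2 ℓ) :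
    Fin 4 → F2 ℓ :=
  ![y, y + x (s 0) (c 0) + x (s 1) (c 0),
    y + x (s 0) (c 0) + x (s 1) (c 0) + x (s 1) (c 1) + x (s 2) (c 1),
    y + x (s 0) (c 0) + x (s 1) (c 0) + x (s 1) (c 1) + x (s 2) (c 1) + x (s 2) (c 2)
      + x (s 3) (c 2)]

/-- The check nodes of the lift with base point `(s 0, y)`. -/
def liftRow (x : Fin nc → Fin nv → F2 ℓ) (s : Fin 4 → Fin nc) (c : Fin 4 → Fin nv) (y : F2 ℓ)
    (t : Fin 4) : Fin nc × F2 ℓ := (s t, liftShift x s c y t)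

/-- The variable nodes of the lift with base point `(s 0, y)`. -/
def liftCol (x : Fin nc → Fin nv → F2 ℓ) (s : Fin 4 → Fin nc) (c : Fin 4 → Fin nv) (y : F2 ℓ)
    (t : Fin 4) : Fin nv × F2 ℓ := (c t, liftShift x s c y t + x (s t) (c t))

lemma isOctagon_iff {k : Fin 4 → Fin nc × F2 ℓ} {v : Fin 4 → Fin nv × F2 ℓ} :
    IsOctagon (tannerGraph (parityCheck x)) k v ↔
      ∀ t, (v t).2 = (k t).2 + x (k t).1 (v t).1 ∧
        (v t).2 = (k (t + 1)).2 + x (k (t + 1)).1 (v t).1 :=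
  forall_congr' fun _ => and_congr (tanner_adj _ _ _ _) (tanner_adj' _ _ _ _)

lemma isOctagon_lift {s : Fin 4 → Fin nc} {c : Fin 4 → Fin nv} (h : walkSum x s c = 0) (y : F2 ℓ) :
    IsOctagon (tannerGraph (parityCheck x)) (liftRow x s c y) (liftCol x s c y) := by
  -- Characteristic 2 in the form usable by `linear_combination`.
  have h2 : ∀ y : F2 ℓ, 2 * y = 0 := fun y => by rw [two_mul, F2.add_self]
  rw [isOctagon_iff]
  simp only [walkSum, Fin.sum_univ_four, Fin.isValue, Fin.reduceAdd] at h
  intro t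
  refine ⟨rfl, ?_⟩
  fin_cases t <;> simp [liftRow, liftCol, liftShift]
  · linear_combination -h2 (x (s 1) (c 0))
  · linear_combination -h2 (x (s 2) (c 1))
  · linear_combination -h2 (x (s 3) (c 2))
  · linear_combination h - h2 (x (s 0) (c 3))

lemma eq_lift_of_isOctagon {k : Fin 4 → Fin nc × F2 ℓ} {v : Fin 4 → Fin nv × F2 ℓ}
    (h : IsOctagon (tannerGraph (parityCheck x)) k v) :
    walkSum x (Prod.fst ∘ k) (Prod.fst ∘ v) = 0 ∧
      k = liftRow x (Prod.fst ∘ k) (Prod.fst ∘ v) (k 0).2 ∧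
      v = liftCol x (Prod.fst ∘ k) (Prod.fst ∘ v) (k 0).2 := by
  have h2 : ∀ y : F2 ℓ, 2 * y = 0 := fun y => by rw [two_mul, F2.add_self]
  rw [isOctagon_iff] at h
  have e : ∀ t, (k (t + 1)).2 = (k t).2 + x (k t).1 (v t).1 + x (k (t + 1)).1 (v t).1 := by
    intro t
    linear_combination -(h t).2 + (h t).1 - h2 (x (k (t + 1)).1 (v t).1)
  have e0 := e 0
  have e1 := e 1
  have e2 := e 2
  have e3 := e 3
  simp only [Fin.isValue, Fin.reduceAdd] at e0 e1 e2 e3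
  have hk : ∀ t, (k t).2 = liftShift x (Prod.fst ∘ k) (Prod.fst ∘ v) (k 0).2 t := by
    intro t
    fin_cases t
    · rfl
    · exact e0
    · exact e1.trans (by rw [e0]; rfl)
    · exact e2.trans (by rw [e1, e0]; rfl)
  refine ⟨?_, funext fun t => Prod.ext rfl (hk t), funext fun t => Prod.ext rfl ?_⟩
  · simp only [walkSum, Fin.sum_univ_four, Fin.isValue, Fin.reduceAdd, Function.comp]
    -- Once around the walk, the second components of the check nodes cancel and only the shifts
    -- remain.
    linear_combination -e0 - e1 - e2 - e3
  · exact (h t).1.trans (by rw [hk t]; rfl)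

/-- Without 4-cycles in the Tanner graph, two distinct checks share at most one variable. -/
lemma eq_or_eq_of_egirth (hg : (8 : ℕ∞) < 2 * (tannerGraph (parityCheck x)).egirth)
    {k₀ k₁ : Fin nc × F2 ℓ} {v₀ v₁ : Fin nv × F2 ℓ}
    (h₀ : (tannerGraph (parityCheck x)).Adj (Sum.inl k₀) (Sum.inr v₀))
    (h₁ : (tannerGraph (parityCheck x)).Adj (Sum.inr v₀) (Sum.inl k₁))
    (h₂ : (tannerGraph (parityCheck x)).Adj (Sum.inl k₁) (Sum.inr v₁))
    (h₃ : (tannerGraph (parityCheck x)).Adj (Sum.inr v₁) (Sum.inl k₀)) : k₀ = k₁ ∨ v₀ = v₁ := by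
  by_contra! hne
  obtain ⟨hk, hv⟩ := hne
  let p : (tannerGraph (parityCheck x)).Walk (Sum.inl k₀) (Sum.inl k₀) :=
    .cons h₀ <| .cons h₁ <| .cons h₂ <| .cons h₃ .nil
  have hp : p.IsCycle := by
    rw [SimpleGraph.Walk.cons_isCycle_iff]
    simp [SimpleGraph.Walk.isPath_def, hk, hk.symm, hv]
  have hl : (tannerGraph (parityCheck x)).egirth ≤ 4 := SimpleGraph.egirth_le_length hp
  have := hg.trans_le (mul_le_mul_right hl 2)
  exact absurd this (by norm_num)

lemma Proper.injective_of_ne {α : Type*} {f : Fin 4 → α} (hf : Proper f) (h₀ : f 0 ≠ f 2)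
    (h₁ : f 1 ≠ f 3) : Function.Injective f := by
  have a0 := hf 0
  have a1 := hf 1
  have a2 := hf 2
  have a3 := hf 3
  simp only [Fin.isValue, Fin.reduceAdd] at a0 a1 a2 a3
  intro s t hst
  fin_cases s <;> fin_cases t <;> simp_all

/-- Equal opposite nodes would close half of the walk to length 4, forcing two consecutive checks or
two consecutive variables to agree. -/
lemma injective_of_proper (hg : (8 : ℕ∞) < 2 * (tannerGraph (parityCheck x)).egirth)
    {k : Fin 4 → Fin nc × F2 ℓ} {v : Fin 4 → Fin nv × F2 ℓ}
    (h : IsOctagon (tannerGraph (parityCheck x)) k v) (hk : Proper k) (hv : Proper v) :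
    Function.Injective k ∧ Function.Injective v := by
  constructor
  · refine hk.injective_of_ne (fun e => ?_) (fun e => ?_)
    · exact (eq_or_eq_of_egirth hg (h 0).1 (h 0).2 (h 1).1 (e ▸ (h 1).2)).elim (hk 0) (hv 0)
    · exact (eq_or_eq_of_egirth hg (h 1).1 (h 1).2 (h 2).1 (e ▸ (h 2).2)).elim (hk 1) (hv 1)
  · refine hv.injective_of_ne (fun e => ?_) (fun e => ?_)
    · exact (eq_or_eq_of_egirth hg (h 1).1 (h 1).2 (h 2).1 (e ▸ (h 0).2)).elim (hk 1) (hv 1)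
    · exact (eq_or_eq_of_egirth hg (h 2).1 (h 2).2 (h 3).1 (e ▸ (h 1).2)).elim (hk 2) (hv 2)

/-- The projection is locally injective: a node has only one neighbour in each block. -/
lemma proper_fst_iff {k : Fin 4 → Fin nc × F2 ℓ} {v : Fin 4 → Fin nv × F2 ℓ}
    (h : IsOctagon (tannerGraph (parityCheck x)) k v) :
    (Proper (Prod.fst ∘ k) ↔ Proper k) ∧ (Proper (Prod.fst ∘ v) ↔ Proper v) := by
  rw [isOctagon_iff] at h
  refine ⟨⟨fun H t e => H t (congrArg Prod.fst e), fun H t e => H t (Prod.ext e ?_)⟩,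
    ⟨fun H t e => H t (congrArg Prod.fst e), fun H t e => H t (Prod.ext e ?_)⟩⟩
  · have h1 := (h t).1.symm.trans (h t).2
    simp only [Function.comp] at e
    rw [e] at h1
    exact add_right_cancel h1
  · rw [(h t).2, (h (t + 1)).1]
    simp only [Function.comp] at e
    rw [e]

/-! ### Counting 8-cycles through their traversals -/

lemma exists_octWalk_of_isCycle {a : (Fin nc × F2 ℓ) ⊕ (Fin nv × F2 ℓ)}
    (p : (tannerGraph (parityCheck x)).Walk a a) (hp : p.IsCycle) (hl : p.length = 8) :
    ∃ (k : Fin 4 → Fin nc × F2 ℓ) (v : Fin 4 → Fin nv × F2 ℓ) (h : IsOctagon _ k v),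
      Function.Injective k ∧ Function.Injective v ∧ p.darts.IsRotated (octWalk k v h).darts :=
  exists_octWalk (fun _ _ h => h) (fun _ _ h => h) p hp hl

/-- The traversals of 8-cycles that begin at a check node. -/
def octagons (x : Fin nc → Fin nv → F2 ℓ) :
    Set ((Fin 4 → Fin nc × F2 ℓ) × (Fin 4 → Fin nv × F2 ℓ)) :=
  {q | IsOctagon (tannerGraph (parityCheck x)) q.1 q.2 ∧ Function.Injective q.1 ∧
    Function.Injective q.2}

lemma cycleSet_eq :
    cycleSet (tannerGraph (parityCheck x)) 8 = (fun q => octEdges q.1 q.2) '' octagons x := by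
  ext S
  constructor
  · rintro ⟨a, p, hp, hl, rfl⟩
    obtain ⟨k, v, h, hk, hv, hr⟩ := exists_octWalk_of_isCycle p hp hl
    refine ⟨(k, v), ⟨h, hk, hv⟩, ?_⟩
    change octEdges k v = _
    rw [← octWalk_edges h]
    ext z
    exact (hr.map (·.edge)).mem_iff.symm
  · rintro ⟨⟨k, v⟩, ⟨h, hk, hv⟩, rfl⟩
    exact ⟨_, octWalk k v h, octWalk_isCycle h hk hv, rfl, (octWalk_edges h).symm⟩

lemma numEightCycles_mul_eight : numEightCycles x * 8 = (octagons x).ncard := by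
  classical
  have e : (octagons x) = ((octagons x).toFinset : Set _) := by simp
  rw [numEightCycles, cycleSet_eq, e, ncard_image_mul_eq, Set.ncard_coe_finset]
  rintro ⟨k, v⟩ h
  rw [Set.mem_toFinset] at h
  obtain ⟨h, hk, hv⟩ := h
  have : {b | b ∈ (octagons x).toFinset ∧ octEdges b.1 b.2 = octEdges k v} =
      (fun e : Bool × Fin 4 => (k ∘ rowIdx e, v ∘ colIdx e)) '' Set.univ := by
    ext ⟨k', v'⟩
    rw [Set.image_univ]
    constructor
    · rintro ⟨h1, h2⟩
      rw [Set.mem_toFinset] at h1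
      obtain ⟨e, he, he'⟩ := exists_of_octEdges_eq hk hv h1.2.1 h1.2.2 h2
      exact ⟨e, Prod.ext he.symm he'.symm⟩
    · rintro ⟨e, he⟩
      obtain ⟨rfl, rfl⟩ := Prod.mk.inj he
      refine ⟨?_, octEdges_comp h e⟩
      rw [Set.mem_toFinset]
      exact ⟨h.comp e, hk.comp (rowIdx_injective e), hv.comp (colIdx_injective e)⟩
  rw [this, Set.ncard_image_of_injective _ (comp_index_injective hk hv), Set.ncard_univ]
  simp

/-- The columns with which the rows `s` give a closed walk that lifts to closed walks. -/
def liftCols (x : Fin nc → Fin nv → F2 ℓ) (s : Fin 4 → Fin nc) : Finset (Fin 4 → Fin nv) :=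
  univ.filter fun c => Proper c ∧ walkSum x s c = 0

lemma lift_injective (hg : (8 : ℕ∞) < 2 * (tannerGraph (parityCheck x)).egirth)
    {s : Fin 4 → Fin nc} {c : Fin 4 → Fin nv} (hs : Proper s) (hc : c ∈ liftCols x s) (y : F2 ℓ) :
    (liftRow x s c y, liftCol x s c y) ∈ octagons x := by
  obtain ⟨hc, h0⟩ := (Finset.mem_filter.1 hc).2
  have h := isOctagon_lift h0 y
  have := proper_fst_iff h
  exact ⟨h, injective_of_proper hg h (this.1.1 hs) (this.2.1 hc)⟩

lemma ncard_octagons (hg : (8 : ℕ∞) < 2 * (tannerGraph (parityCheck x)).egirth) :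
    (octagons x).ncard = 2 ^ ℓ * ∑ s with Proper s, (liftCols x s).card := by
  classical
  have hF : Fintype.card (F2 ℓ) = 2 ^ ℓ := by simp [ZMod.card]
  rw [← Finset.card_sigma, ← hF, ← Finset.card_univ, ← Finset.card_product, ← Set.ncard_coe_finset]
  refine Set.ncard_congr' ?_
  refine ⟨fun q => ⟨((q.1.1 0).2, ⟨Prod.fst ∘ q.1.1, Prod.fst ∘ q.1.2⟩), ?_⟩,
    fun q => ⟨(liftRow x q.1.2.1 q.1.2.2 q.1.1, liftCol x q.1.2.1 q.1.2.2 q.1.1), ?_⟩, ?_, ?_⟩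
  · obtain ⟨⟨k, v⟩, h, hk, hv⟩ := q
    have := proper_fst_iff h
    simp only [liftCols, coe_product, coe_univ, Set.mem_prod, Set.mem_univ, true_and, mem_coe,
      mem_sigma, mem_filter, mem_univ]
    exact ⟨this.1.2 (.of_injective hk), this.2.2 (.of_injective hv), (eq_lift_of_isOctagon h).1⟩
  · obtain ⟨⟨y, s, c⟩, h⟩ := q
    simp only [coe_product, coe_univ, Set.mem_prod, Set.mem_univ, true_and, mem_coe,
      mem_sigma, mem_filter, mem_univ] at h
    exact lift_injective hg h.1 h.2 y
  · rintro ⟨⟨k, v⟩, h, hk, hv⟩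
    exact Subtype.ext (Prod.ext (eq_lift_of_isOctagon h).2.1.symm
      (eq_lift_of_isOctagon h).2.2.symm)
  · rintro ⟨⟨y, s, c⟩, h⟩
    rfl

/-! ### 8-cycles over a fixed protograph walk -/

lemma projection_octWalk {s : Fin 4 → Fin nc} {c : Fin 4 → Fin nv}
    {k : Fin 4 → Fin nc × F2 ℓ} {v : Fin 4 → Fin nv × F2 ℓ}
    (h : IsOctagon (tannerGraph (parityCheck x)) k v) (hk : Prod.fst ∘ k = s)
    (hv : Prod.fst ∘ v = c) :
    ((octWalk k v h).map (projection x)).darts = (rowColWalk s c).darts := by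
  subst hk hv
  rfl

lemma isOctagon_protograph (s : Fin 4 → Fin nc) (c : Fin 4 → Fin nv) :
    IsOctagon (protograph nc nv) s c := fun t => by simp

lemma exists_of_closedEquiv_rowColWalk {s s' : Fin 4 → Fin nc} {c c' : Fin 4 → Fin nv}
    (h : ClosedEquiv (rowColWalk s c) (rowColWalk s' c')) :
    ∃ e, s' = s ∘ rowIdx e ∧ c' = c ∘ colIdx e :=
  exists_of_closedEquiv (h := isOctagon_protograph s c) (h' := isOctagon_protograph s' c') h

lemma eightCyclesOver_eq (hg : (8 : ℕ∞) < 2 * (tannerGraph (parityCheck x)).egirth)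
    {s : Fin 4 → Fin nc} {c : Fin 4 → Fin nv} (hs : Proper s) (hc : c ∈ liftCols x s) :
    eightCyclesOver x (rowColWalk s c) =
      (fun y => octEdges (liftRow x s c y) (liftCol x s c y)) '' Set.univ := by
  have h0 := (Finset.mem_filter.1 hc).2.2
  ext S
  constructor
  · rintro ⟨a, p, hp, hl, rfl, he⟩
    obtain ⟨k, v, h, hk, hv, hr⟩ := exists_octWalk_of_isCycle p hp hl
    have he' : ClosedEquiv (rowColWalk (Prod.fst ∘ k) (Prod.fst ∘ v)) (rowColWalk s c) := by
      have := hr.symm.map (projection x).mapDart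
      rw [← SimpleGraph.Walk.darts_map, ← SimpleGraph.Walk.darts_map,
        projection_octWalk h rfl rfl] at this
      exact he.imp this.trans this.trans
    obtain ⟨e, rfl, rfl⟩ := exists_of_closedEquiv_rowColWalk he'
    -- After the change of base point and direction the traversal projects onto `(s, c)` itself, so
    -- it is the lift from its new first check.
    have hlift := (eq_lift_of_isOctagon (h.comp e)).2
    refine ⟨(k (rowIdx e 0)).2, trivial, ?_⟩
    change octEdges
      (liftRow x (Prod.fst ∘ (k ∘ rowIdx e)) (Prod.fst ∘ (v ∘ colIdx e)) ((k ∘ rowIdx e) 0).2)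
      (liftCol x (Prod.fst ∘ (k ∘ rowIdx e)) (Prod.fst ∘ (v ∘ colIdx e)) ((k ∘ rowIdx e) 0).2) = _
    rw [← hlift.1, ← hlift.2, octEdges_comp h, ← octWalk_edges h]
    ext z
    exact (hr.map (·.edge)).mem_iff.symm
  · rintro ⟨y, -, rfl⟩
    obtain ⟨h, hk, hv⟩ := lift_injective hg hs hc y
    exact ⟨_, octWalk _ _ h, octWalk_isCycle h hk hv, rfl, (octWalk_edges h).symm,
      .inl (by rw [projection_octWalk h rfl rfl]; exact .refl _)⟩

/-- Every rotation or reflection other than the identity and the half turn moves some row or column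
index to a neighbouring one, so it is no symmetry of a proper walk. -/
lemma index_symmetry : ∀ e : Bool × Fin 4, (∃ t, rowIdx e t = t + 1) ∨ (∃ t, colIdx e t = t + 1) ∨
    (∃ t, rowIdx e t = t - 1) ∨ e = (false, 0) ∨ e = (false, 2) := by decide

lemma eq_zero_or_two_of_symmetry {s : Fin 4 → Fin nc} {c : Fin 4 → Fin nv} (hs : Proper s)
    (hc : Proper c) {e : Bool × Fin 4} (h₁ : s = s ∘ rowIdx e) (h₂ : c = c ∘ colIdx e) :
    e = (false, 0) ∨ e = (false, 2) := by
  obtain ⟨t, h⟩ | ⟨t, h⟩ | ⟨t, h⟩ | h := index_symmetry e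
  · exact (hs t (by simpa [h] using congrFun h₁ t)).elim
  · exact (hc t (by simpa [h] using congrFun h₂ t)).elim
  · refine (hs (t - 1) ?_).elim
    rw [sub_add_cancel]
    simpa [h] using (congrFun h₁ t).symm
  · exact h

lemma ncard_eightCyclesOver (hg : (8 : ℕ∞) < 2 * (tannerGraph (parityCheck x)).egirth)
    {s : Fin 4 → Fin nc} {c : Fin 4 → Fin nv} (hs : Proper s) (hc : c ∈ liftCols x s) :
    (eightCyclesOver x (rowColWalk s c)).ncard *
      (if s 0 = s 2 ∧ s 1 = s 3 ∧ c 0 = c 2 ∧ c 1 = c 3 then 2 else 1) = 2 ^ ℓ := by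
  have hF : Fintype.card (F2 ℓ) = 2 ^ ℓ := by simp [ZMod.card]
  obtain ⟨hc', h0⟩ := (Finset.mem_filter.1 hc).2
  rw [eightCyclesOver_eq hg hs hc, ← Finset.coe_univ, ncard_image_mul_eq, Finset.card_univ, hF]
  intro y _
  have hy := lift_injective hg hs hc y
  have key : ∀ y', octEdges (liftRow x s c y') (liftCol x s c y') =
      octEdges (liftRow x s c y) (liftCol x s c y) ↔
      ∃ e, liftRow x s c y' = liftRow x s c y ∘ rowIdx e ∧
        liftCol x s c y' = liftCol x s c y ∘ colIdx e := by
    intro y'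
    have hy' := lift_injective hg hs hc y'
    refine ⟨exists_of_octEdges_eq hy.2.1 hy.2.2 hy'.2.1 hy'.2.2, ?_⟩
    rintro ⟨e, h1, h2⟩
    rw [h1, h2, octEdges_comp hy.1]
  simp only [key, mem_univ, true_and]
  have hsub : ∀ y' e, liftRow x s c y' = liftRow x s c y ∘ rowIdx e →
      liftCol x s c y' = liftCol x s c y ∘ colIdx e →
      (s = s ∘ rowIdx e ∧ c = c ∘ colIdx e) ∧ y' = liftShift x s c y (rowIdx e 0) := by
    intro y' e h1 h2
    exact ⟨⟨congrArg (Prod.fst ∘ ·) h1, congrArg (Prod.fst ∘ ·) h2⟩,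
      congrArg Prod.snd (congrFun h1 0)⟩
  have hid : liftRow x s c y = liftRow x s c y ∘ rowIdx (false, 0) ∧
      liftCol x s c y = liftCol x s c y ∘ colIdx (false, 0) := by
    constructor <;> ext1 t <;> simp [rowIdx, colIdx]
  split_ifs with hsym
  · obtain ⟨s02, s13, c02, c13⟩ := hsym
    have hss : s = s ∘ rowIdx (false, 2) := by
      ext1 t; fin_cases t
      exacts [s02, s13, s02.symm, s13.symm]
    have hcc : c = c ∘ colIdx (false, 2) := by
      ext1 t; fin_cases t
      exacts [c02, c13, c02.symm, c13.symm]
    -- The half turn exchanges the lift from `y` with the lift from the third check; these differ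
    -- because a lift repeats no check.
    have hne : liftShift x s c y 2 ≠ y := fun h => by
      have : liftRow x s c y 2 = liftRow x s c y 0 := Prod.ext s02.symm h
      exact absurd (hy.2.1 this) (by decide)
    have : {y' | ∃ e, liftRow x s c y' = liftRow x s c y ∘ rowIdx e ∧
        liftCol x s c y' = liftCol x s c y ∘ colIdx e} = {y, liftShift x s c y 2} := by
      ext y'
      constructor
      · rintro ⟨e, h1, h2⟩
        obtain ⟨⟨hs', hc''⟩, hy'⟩ := hsub y' e h1 h2
        obtain rfl | rfl := eq_zero_or_two_of_symmetry hs hc' hs' hc''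
        exacts [.inl hy', .inr hy']
      · rintro (rfl | rfl)
        · exact ⟨_, hid⟩
        · have hl := (eq_lift_of_isOctagon (hy.1.comp (false, 2))).2
          have e1 : Prod.fst ∘ liftRow x s c y ∘ rowIdx (false, 2) = s := hss.symm
          have e2 : Prod.fst ∘ liftCol x s c y ∘ colIdx (false, 2) = c := hcc.symm
          simp only [e1, e2] at hl
          exact ⟨(false, 2), hl.1.symm, hl.2.symm⟩
    rw [this, Set.ncard_pair hne.symm]
  · have : {y' | ∃ e, liftRow x s c y' = liftRow x s c y ∘ rowIdx e ∧
        liftCol x s c y' = liftCol x s c y ∘ colIdx e} = {y} := by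
      ext y'
      constructor
      · rintro ⟨e, h1, h2⟩
        obtain ⟨⟨hs', hc''⟩, hy'⟩ := hsub y' e h1 h2
        obtain rfl | rfl := eq_zero_or_two_of_symmetry hs hc' hs' hc''
        · exact hy'
        · exact (hsym ⟨congrFun hs' 0, congrFun hs' 1, congrFun hc'' 0, congrFun hc'' 1⟩).elim
      · rintro rfl
        exact ⟨_, hid⟩
    rw [this, Set.ncard_singleton]

end Tanner

/-! ### Row sequences as increasing rows and words -/

section RowSums

/-- The strictly increasing maps. -/
def strictMonos (d n : ℕ) : Finset (Fin d → Fin n) := univ.filter fun r => ∀ a b, a < b → r a < r b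

lemma mem_strictMonos {d n : ℕ} {r : Fin d → Fin n} : r ∈ strictMonos d n ↔ StrictMono r := by
  simp [strictMonos, StrictMono]

/-- The proper surjective words of length 4 on `d` letters. -/
def words (d : ℕ) : Finset (Fin 4 → Fin d) :=
  univ.filter fun w => Proper w ∧ ∀ a, ∃ t, w t = a

lemma exists_strictMono_of_image {α : Type*} [Fintype α] {d n : ℕ} (A : Finset (Fin n))
    (hA : A.card = d) (f : α → Fin n) (hf : ∀ a, f a ∈ A) :
    ∃ r ∈ strictMonos d n, univ.image r = A ∧ ∃ e : α → Fin d, f = r ∘ e := by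
  refine ⟨A.orderEmbOfFin hA, mem_strictMonos.2 (A.orderEmbOfFin hA).strictMono, by simp, ?_⟩
  have : ∀ a, ∃ t, A.orderEmbOfFin hA t = f a := fun a => by
    have : f a ∈ Set.range (A.orderEmbOfFin hA) := by simpa using hf a
    exact this
  choose e he using this
  exact ⟨e, funext fun a => (he a).symm⟩

lemma eq_of_image_eq {d n : ℕ} {r r' : Fin d → Fin n} (hr : r ∈ strictMonos d n)
    (hr' : r' ∈ strictMonos d n) (h : univ.image r = univ.image r') : r = r' := by
  rw [mem_strictMonos] at hr hr'
  refine (hr.range_inj hr').1 ?_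
  simpa using congrArg (fun A : Finset (Fin n) => (A : Set (Fin n))) h

/-- `r` lists the values of `s` increasingly and `w` records their ranks, so `s` determines both. -/
lemma sum_card_image_eq {n : ℕ} (d : ℕ) (g : (Fin 4 → Fin n) → ℚ) :
    ∑ s : Fin 4 → Fin n with Proper s ∧ (univ.image s).card = d, g s =
      ∑ r ∈ strictMonos d n, ∑ w ∈ words d, g (r ∘ w) := by
  rw [← Finset.sum_product']
  symm
  refine Finset.sum_bij (fun q _ => q.1 ∘ q.2) ?_ ?_ ?_ (fun _ _ => rfl)
  · rintro ⟨r, w⟩ h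
    obtain ⟨hr, hw⟩ := Finset.mem_product.1 h
    simp only [words, mem_filter, mem_univ, true_and] at hw
    have hri := (mem_strictMonos.1 hr).injective
    simp only [mem_filter, mem_univ, true_and]
    refine ⟨fun t e => hw.1 t (hri e), ?_⟩
    rw [← Finset.image_image, Finset.image_univ_of_surjective hw.2,
      Finset.card_image_of_injective _ hri]
    simp
  · rintro ⟨r, w⟩ h ⟨r', w'⟩ h' e
    obtain ⟨hr, hw⟩ := Finset.mem_product.1 h
    obtain ⟨hr', hw'⟩ := Finset.mem_product.1 h'
    simp only [words, mem_filter, mem_univ, true_and] at hw hw' e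
    have : r = r' := by
      refine eq_of_image_eq hr hr' ?_
      have := congrArg (univ.image ·) e
      simpa only [← Finset.image_image, Finset.image_univ_of_surjective hw.2,
        Finset.image_univ_of_surjective hw'.2] using this
    subst this
    rw [(mem_strictMonos.1 hr).injective.comp_left e]
  · intro s hs
    simp only [mem_filter, mem_univ, true_and] at hs
    obtain ⟨r, hr, hA, w, rfl⟩ := exists_strictMono_of_image _ hs.2 s (fun a => by simp)
    have hri := (mem_strictMonos.1 hr).injective
    refine ⟨(r, w), Finset.mem_product.2 ⟨hr, ?_⟩, rfl⟩
    simp only [words, mem_filter, mem_univ, true_and]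
    refine ⟨fun t e => hs.1 t (congrArg r e), fun a => ?_⟩
    have : r a ∈ univ.image (r ∘ w) := hA ▸ mem_image_of_mem _ (mem_univ _)
    obtain ⟨t, -, ht⟩ := Finset.mem_image.1 this
    exact ⟨t, hri ht⟩

lemma Proper.card_image {n : ℕ} {s : Fin 4 → Fin n} (hs : Proper s) :
    (univ.image s).card ∈ ({2, 3, 4} : Finset ℕ) := by
  have h4 : (univ.image s).card ≤ 4 := Finset.card_image_le.trans (by simp)
  have h2 : 1 < (univ.image s).card :=
    Finset.one_lt_card.2 ⟨s 0, by simp, s 1, by simp, hs 0⟩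
  interval_cases (univ.image s).card <;> simp

lemma sum_proper_eq {n : ℕ} (g : (Fin 4 → Fin n) → ℚ) :
    ∑ s : Fin 4 → Fin n with Proper s, g s =
      ∑ r ∈ strictMonos 2 n, ∑ w ∈ words 2, g (r ∘ w) +
      ∑ r ∈ strictMonos 3 n, ∑ w ∈ words 3, g (r ∘ w) +
      ∑ r ∈ strictMonos 4 n, ∑ w ∈ words 4, g (r ∘ w) := by
  rw [← Finset.sum_fiberwise_of_maps_to (t := {2, 3, 4}) (g := fun s => (univ.image s).card)
    (fun s hs => (Finset.mem_filter.1 hs).2.card_image)]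
  simp [Finset.filter_filter, sum_card_image_eq, add_assoc]

/-- Here and in the next two lemmas, the number of copies of `words d` is the order of the
stabiliser of a word: 4, 2 and 1. -/
lemma words_two_val : (words 2).val + (words 2).val + (words 2).val + (words 2).val =
    (univ : Finset (Bool × Fin 4)).val.map (fun e => ![0, 1, 0, 1] ∘ rowIdx e) := by
  decide +kernel

lemma words_three_val : (words 3).val + (words 3).val =
    (univ : Finset (Bool × Fin 4)).val.map (fun e => ![0, 1, 0, 2] ∘ rowIdx e) +
    (univ : Finset (Bool × Fin 4)).val.map (fun e => ![0, 2, 1, 2] ∘ rowIdx e) +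
    (univ : Finset (Bool × Fin 4)).val.map (fun e => ![0, 1, 2, 1] ∘ rowIdx e) := by
  decide +kernel

lemma words_four_val : (words 4).val =
    (univ : Finset (Bool × Fin 4)).val.map (fun e => ![0, 2, 1, 3] ∘ rowIdx e) +
    (univ : Finset (Bool × Fin 4)).val.map (fun e => ![0, 1, 2, 3] ∘ rowIdx e) +
    (univ : Finset (Bool × Fin 4)).val.map (fun e => ![0, 1, 3, 2] ∘ rowIdx e) := by
  decide +kernel

section Words

variable {d : ℕ} {g : (Fin 4 → Fin d) → ℚ}

lemma sum_map_rowIdx (hg : ∀ w e, g (w ∘ rowIdx e) = g w) (w : Fin 4 → Fin d) :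
    (((univ : Finset (Bool × Fin 4)).val.map fun e => w ∘ rowIdx e).map g).sum = 8 * g w := by
  rw [Multiset.map_map]
  change ∑ e : Bool × Fin 4, g (w ∘ rowIdx e) = _
  simp [hg]

lemma sum_words_two {g : (Fin 4 → Fin 2) → ℚ} (hg : ∀ w e, g (w ∘ rowIdx e) = g w) :
    ∑ w ∈ words 2, g w = 2 * g ![0, 1, 0, 1] := by
  have := congrArg (fun m => (m.map g).sum) words_two_val
  simp only [Multiset.map_add, Multiset.sum_add, sum_map_rowIdx hg] at this
  change ∑ w ∈ words 2, g w + ∑ w ∈ words 2, g w + ∑ w ∈ words 2, g w + ∑ w ∈ words 2, g w = _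
    at this
  linarith

lemma sum_words_three {g : (Fin 4 → Fin 3) → ℚ} (hg : ∀ w e, g (w ∘ rowIdx e) = g w) :
    ∑ w ∈ words 3, g w = 4 * (g ![0, 1, 0, 2] + g ![0, 2, 1, 2] + g ![0, 1, 2, 1]) := by
  have := congrArg (fun m => (m.map g).sum) words_three_val
  simp only [Multiset.map_add, Multiset.sum_add, sum_map_rowIdx hg] at this
  change ∑ w ∈ words 3, g w + ∑ w ∈ words 3, g w = _ at this
  linarith

lemma sum_words_four {g : (Fin 4 → Fin 4) → ℚ} (hg : ∀ w e, g (w ∘ rowIdx e) = g w) :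
    ∑ w ∈ words 4, g w = 8 * (g ![0, 2, 1, 3] + g ![0, 1, 2, 3] + g ![0, 1, 3, 2]) := by
  have := congrArg (fun m => (m.map g).sum) words_four_val
  simp only [Multiset.map_add, Multiset.sum_add, sum_map_rowIdx hg] at this
  change ∑ w ∈ words 4, g w = _ at this
  linarith

end Words

lemma comp_mem_strictMonos {d n N : ℕ} {r : Fin n → Fin N} {e : Fin d → Fin n}
    (hr : r ∈ strictMonos n N) (he : e ∈ strictMonos d n) : r ∘ e ∈ strictMonos d N :=
  mem_strictMonos.2 ((mem_strictMonos.1 hr).comp (mem_strictMonos.1 he))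

/-- A factorization is determined by the image of its outer map, which can be any `D`-set containing
the image of `f`. -/
lemma card_factorizations {d n : ℕ} (D : ℕ) (hd : d ≤ D) {f : Fin d → Fin n}
    (hf : f ∈ strictMonos d n) :
    ((strictMonos D n ×ˢ strictMonos d D).filter fun q => q.1 ∘ q.2 = f).card =
      (n - d).choose (D - d) := by
  have hfi := (mem_strictMonos.1 hf).injective
  have hc : (univ.image f).card = d := by simp [Finset.card_image_of_injective _ hfi]
  have := card_filter_powersetCard_subset (univ.image f) univ D (Finset.subset_univ _)
    (hc.trans_le hd)
  rw [hc, Finset.card_univ, Fintype.card_fin] at this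
  rw [← this]
  refine Finset.card_bij (fun q _ => univ.image q.1) ?_ ?_ ?_
  · rintro ⟨r, e⟩ h
    simp only [mem_filter, mem_product] at h
    obtain ⟨⟨hr, he⟩, rfl⟩ := h
    simp only [mem_filter, mem_powersetCard, subset_univ, true_and]
    refine ⟨by simp [Finset.card_image_of_injective _ (mem_strictMonos.1 hr).injective], ?_⟩
    rw [← Finset.image_image]
    exact Finset.image_subset_image (Finset.subset_univ _)
  · rintro ⟨r, e⟩ h ⟨r', e'⟩ h' heq
    simp only [mem_filter, mem_product] at h h'
    obtain rfl := eq_of_image_eq h.1.1 h'.1.1 heq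
    rw [(mem_strictMonos.1 h.1.1).injective.comp_left (h.2.trans h'.2.symm)]
  · intro A hA
    simp only [mem_filter, mem_powersetCard, subset_univ, true_and] at hA
    obtain ⟨r, hr, hrA, e, rfl⟩ := exists_strictMono_of_image A hA.1 f
      (fun a => hA.2 (by simp))
    refine ⟨(r, e), ?_, hrA⟩
    simp only [mem_filter, mem_product, and_true]
    refine ⟨hr, mem_strictMonos.2 fun a b hab => ?_⟩
    exact (mem_strictMonos.1 hr).lt_iff_lt.1 (mem_strictMonos.1 hf hab)

lemma sum_strictMonos_comp {d n : ℕ} (D : ℕ) (hd : d ≤ D) (g : (Fin d → Fin n) → ℚ) :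
    ∑ r ∈ strictMonos D n, ∑ e ∈ strictMonos d D, g (r ∘ e) =
      (n - d).choose (D - d) * ∑ r ∈ strictMonos d n, g r := by
  rw [← Finset.sum_product', ← Finset.sum_fiberwise_of_maps_to (t := strictMonos d n)
    (g := fun q => q.1 ∘ q.2), Finset.mul_sum]
  · refine Finset.sum_congr rfl fun f hf => ?_
    rw [← card_factorizations D hd hf, ← nsmul_eq_mul, ← Finset.sum_const]
    exact Finset.sum_congr rfl fun q hq => by rw [(Finset.mem_filter.1 hq).2]
  · intro q hq
    exact comp_mem_strictMonos (Finset.mem_product.1 hq).1 (Finset.mem_product.1 hq).2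

end RowSums

/-! ### Repetitions and columns with zero shift sum -/

section Repetitions

variable {ℓ nc nv : ℕ} (x : Fin nc → Fin nv → F2 ℓ) (s : Fin 4 → Fin nc)

lemma mem_shiftMultiset {a b c : Fin nc} {u v : Fin nv} {α : F2 ℓ} :
    (u, v, α) ∈ shiftMultiset x a b c ↔ u ≠ v ∧ x a u + x b u + x b v + x c v = α := by
  simp only [shiftMultiset, Multiset.mem_map, Finset.mem_val, mem_filter, mem_univ, true_and,
    Prod.mk.injEq, Prod.exists]
  constructor
  · rintro ⟨u, v, h, rfl, rfl, h'⟩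
    exact ⟨h, h'⟩
  · rintro ⟨h, h'⟩
    exact ⟨u, v, h, rfl, rfl, h'⟩

lemma shiftMultiset_nodup (a b c : Fin nc) : (shiftMultiset x a b c).Nodup :=
  (Finset.nodup _).map fun _ _ h => Prod.ext (Prod.mk.inj h).1 (Prod.mk.inj (Prod.mk.inj h).2).1

/-- Rows `s 0` and `s 2` cut the walk into two halves, through `s 1` and through `s 3`. In
characteristic 2 the total vanishes iff the half sums agree. The multisets and the repetition each
give two of the four conditions in `Proper c`. -/
lemma mem_liftCols {c : Fin 4 → Fin nv} : c ∈ liftCols x s ↔ ∃ α,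
    (c 0, c 1, α) ∈ A₁ x s ∧ (c 3, c 2, α) ∈ A₂ x s ∧ c 0 ≠ c 3 ∧ c 1 ≠ c 2 := by
  have hp : Proper c ↔ c 0 ≠ c 1 ∧ c 1 ≠ c 2 ∧ c 2 ≠ c 3 ∧ c 3 ≠ c 0 := by
    simp [Proper, Fin.forall_fin_succ]
  have hw : walkSum x s c = 0 ↔ x (s 0) (c 0) + x (s 1) (c 0) + x (s 1) (c 1) + x (s 2) (c 1) =
      x (s 0) (c 3) + x (s 3) (c 3) + x (s 3) (c 2) + x (s 2) (c 2) := by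
    rw [eq_comm (b := x (s 0) (c 3) + _ + _ + _), ← add_zero (_ + _ + _ + x (s 2) (c 1)),
      ← F2.add_eq_iff]
    simp only [walkSum, Fin.sum_univ_four, Fin.isValue, Fin.reduceAdd]
    refine Eq.congr ?_ rfl
    abel
  simp only [liftCols, mem_filter, mem_univ, true_and, A₁, A₂, mem_shiftMultiset, hp, hw]
  constructor
  · rintro ⟨⟨h1, h2, h3, h4⟩, h⟩
    exact ⟨_, ⟨h1, h⟩, ⟨h3.symm, rfl⟩, h4.symm, h2⟩
  · rintro ⟨α, ⟨h1, h⟩, ⟨h3, rfl⟩, h4, h2⟩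
    exact ⟨⟨h1, h2, h3.symm, h4.symm⟩, h⟩

lemma numRep_eq_card_liftCols : numRep x s = (liftCols x s).card := by
  have hn : (repetitions (A₁ x s) (A₂ x s)).Nodup :=
    ((shiftMultiset_nodup ..).product (shiftMultiset_nodup ..)).filter _
  change Finset.card ⟨_, hn⟩ = _
  refine Finset.card_bij' (fun q _ => ![q.1.1, q.1.2.1, q.2.2.1, q.2.1])
    (fun c _ => ((c 0, c 1, x (s 0) (c 0) + x (s 1) (c 0) + x (s 1) (c 1) + x (s 2) (c 1)),
      (c 3, c 2, x (s 0) (c 3) + x (s 3) (c 3) + x (s 3) (c 2) + x (s 2) (c 2)))) ?_ ?_ ?_ ?_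
  · rintro ⟨⟨u, v, α⟩, ⟨u', v', α'⟩⟩ h
    simp only [repetitions, Finset.mem_mk, Multiset.mem_filter, Multiset.mem_product] at h
    obtain ⟨⟨h1, h2⟩, rfl, h3, h4⟩ := h
    exact (mem_liftCols x s).2 ⟨α, h1, h2, h3, h4⟩
  · intro c hc
    obtain ⟨α, h1, h2, h3, h4⟩ := (mem_liftCols x s).1 hc
    simp only [repetitions, Finset.mem_mk, Multiset.mem_filter, Multiset.mem_product]
    rw [((mem_shiftMultiset x).1 h1).2, ((mem_shiftMultiset x).1 h2).2]
    exact ⟨⟨h1, h2⟩, rfl, h3, h4⟩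
  · rintro ⟨⟨u, v, α⟩, ⟨u', v', α'⟩⟩ h
    simp only [repetitions, Finset.mem_mk, Multiset.mem_filter, Multiset.mem_product] at h
    obtain ⟨⟨h1, h2⟩, rfl, h3, h4⟩ := h
    have e1 := ((mem_shiftMultiset x).1 h1).2
    have e2 := ((mem_shiftMultiset x).1 h2).2
    simp [e1, e2]
  · intro c _
    ext1 t
    fin_cases t <;> rfl

/-- Both kinds of repetition carry the weight `2 ^ ℓ / 4`. -/
lemma starCount_eq : starCount x s = 2 ^ ℓ / 4 * numRep x s := by
  have : numRep x s = numRepC x s + numRepNC x s := by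
    rw [numRep, numRepC, numRepNC, ← Multiset.card_add, Multiset.filter_add_not]
  rw [starCount, this]
  push_cast
  ring

lemma walkSum_comp (c : Fin 4 → Fin nv) (e : Bool × Fin 4) :
    walkSum x (s ∘ rowIdx e) (c ∘ colIdx e) = walkSum x s c := by
  obtain ⟨_ | _, j⟩ := e
  · rw [walkSum, walkSum, ← Equiv.sum_comp (Equiv.addLeft j) fun t =>
      x (s t) (c t) + x (s (t + 1)) (c t)]
    simp [rowIdx, colIdx, add_assoc]
  -- Reversal puts column `j - 1 - t` in place `t` and exchanges its two rows.
  · rw [walkSum, walkSum, ← Equiv.sum_comp (Equiv.subLeft (j - 1)) fun t =>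
      x (s t) (c t) + x (s (t + 1)) (c t)]
    refine Finset.sum_congr rfl fun t _ => ?_
    simp only [rowIdx, colIdx, Function.comp, if_true, Equiv.subLeft_apply]
    rw [show j - 1 - t + 1 = j - t by abel, show j - 1 - t = j - t - 1 by abel,
      show j - (t + 1) = j - t - 1 by abel, add_comm]

lemma card_liftCols_le (e : Bool × Fin 4) :
    (liftCols x s).card ≤ (liftCols x (s ∘ rowIdx e)).card := by
  refine Finset.card_le_card_of_injOn (fun c => c ∘ colIdx e) ?_ ?_
  · intro c hc
    obtain ⟨hc, h0⟩ := (Finset.mem_filter.1 hc).2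
    exact Finset.mem_filter.2 ⟨mem_univ _, proper_comp_colIdx hc e, by rw [walkSum_comp, h0]⟩
  · intro c _ c' _ h
    exact (Finite.surjective_of_injective (colIdx_injective e)).injective_comp_right h

/-- Index changes are invertible, so the inequality `card_liftCols_le` for all of them gives
equality. -/
lemma numRep_comp (e : Bool × Fin 4) : numRep x (s ∘ rowIdx e) = numRep x s := by
  rw [numRep_eq_card_liftCols, numRep_eq_card_liftCols]
  refine le_antisymm ?_ (card_liftCols_le x s e)
  have : ∀ e, ∃ e', rowIdx e ∘ rowIdx e' = id := by decide
  obtain ⟨e', he'⟩ := this e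
  refine (card_liftCols_le x _ e').trans_eq ?_
  rw [Function.comp_assoc, he', Function.comp_id]

/-- The number of 8-cycles as a sum over the words on two, three and four rows. -/
lemma numEightCycles_eq (hg : (8 : ℕ∞) < 2 * (tannerGraph (parityCheck x)).egirth) :
    (numEightCycles x : ℚ) =
      ∑ r ∈ strictMonos 2 nc, 2 ^ ℓ / 4 * (numRep x (r ∘ ![0, 1, 0, 1]) : ℚ) +
      ∑ r ∈ strictMonos 3 nc, 2 ^ ℓ / 2 * ((numRep x (r ∘ ![0, 1, 0, 2]) : ℚ) +
        numRep x (r ∘ ![0, 2, 1, 2]) + numRep x (r ∘ ![0, 1, 2, 1])) +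
      ∑ r ∈ strictMonos 4 nc, 2 ^ ℓ * ((numRep x (r ∘ ![0, 2, 1, 3]) : ℚ) +
        numRep x (r ∘ ![0, 1, 2, 3]) + numRep x (r ∘ ![0, 1, 3, 2])) := by
  have h8 : (numEightCycles x : ℚ) * 8 = 2 ^ ℓ * ∑ s with Proper s, (numRep x s : ℚ) := by
    simp only [numRep_eq_card_liftCols]
    exact_mod_cast numEightCycles_mul_eight.trans (ncard_octagons hg)
  have hinv : ∀ {d : ℕ} (r : Fin d → Fin nc) (w : Fin 4 → Fin d) e,
      (numRep x (r ∘ (w ∘ rowIdx e)) : ℚ) = numRep x (r ∘ w) := fun r w e => by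
    rw [← Function.comp_assoc, numRep_comp]
  rw [sum_proper_eq, Finset.sum_congr rfl fun r _ => sum_words_two (hinv r),
    Finset.sum_congr rfl fun r _ => sum_words_three (hinv r),
    Finset.sum_congr rfl fun r _ => sum_words_four (hinv r)] at h8
  simp only [← Finset.mul_sum] at h8 ⊢
  linarith

end Repetitions

/-! ### The 21 patterns and the final sums -/

section Patterns

variable {ℓ nc nv : ℕ} {x : Fin nc → Fin nv → F2 ℓ}

lemma strictMonos_two (n : ℕ) : strictMonos 2 n = univ.filter fun r => r 0 < r 1 := by
  ext r
  simp [strictMonos, Fin.forall_fin_succ]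

lemma strictMonos_three (n : ℕ) :
    strictMonos 3 n = univ.filter fun r => r 0 < r 1 ∧ r 1 < r 2 := by
  ext r
  rw [mem_strictMonos, Fin.strictMono_iff_lt_succ]
  simp [Fin.forall_fin_succ]

lemma strictMonos_four (n : ℕ) :
    strictMonos 4 n = univ.filter fun r => r 0 < r 1 ∧ r 1 < r 2 ∧ r 2 < r 3 := by
  ext r
  rw [mem_strictMonos, Fin.strictMono_iff_lt_succ]
  simp [Fin.forall_fin_succ]

lemma strictMonos_two_four :
    strictMonos 2 4 = {![0, 1], ![0, 2], ![0, 3], ![1, 2], ![1, 3], ![2, 3]} := by decide +kernel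

lemma strictMonos_three_four :
    strictMonos 3 4 = {![0, 1, 2], ![0, 1, 3], ![0, 2, 3], ![1, 2, 3]} := by decide +kernel

lemma comp_four {d : ℕ} {α : Type*} (r : Fin d → α) (a b c e : Fin d) :
    r ∘ ![a, b, c, e] = ![r a, r b, r c, r e] := by
  ext1 t
  fin_cases t <;> rfl

lemma pattern_proper (m : Fin 21) : Proper (pattern m) := by
  revert m
  decide

/-- The proper words on four letters form 6 + 4 · 3 + 3 = 21 dihedral orbits, with two, three and
four distinct letters; each contains exactly one pattern, by this lemma and `exists_pattern`. -/
lemma pattern_unique : ∀ m m' e, pattern m ∘ rowIdx e = pattern m' → m = m' := by decide +kernel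

lemma exists_pattern : ∀ w : Fin 4 → Fin 4, Proper w → ∃ m e, w ∘ rowIdx e = pattern m := by
  decide +kernel

lemma IsPatternRows.proper {m : Fin 21} {r : Fin 4 → ℕ} {s : Fin 4 → Fin nc}
    (h : IsPatternRows m r s) : Proper s := fun t e =>
  pattern_proper m t (h.1.injective (by rw [← h.2, ← h.2, e]))

lemma patterns_nonequivalent {r : Fin 4 → ℕ} {m m' : Fin 21} {s s' : Fin 4 → Fin nc}
    {c c' : Fin 4 → Fin nv} (h : IsPatternRows m r s) (h' : IsPatternRows m' r s')
    (he : ClosedEquiv (rowColWalk s c) (rowColWalk s' c')) : m = m' := by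
  obtain ⟨e, rfl, -⟩ := exists_of_closedEquiv_rowColWalk he
  refine pattern_unique m m' e (funext fun t => h.1.injective ?_)
  rw [← h'.2 t]
  exact (h.2 _).symm

/-- Any four numbers below `n` are covered by four increasing ones, below `n` when `4 ≤ n`. -/
lemma exists_strictMono_cover {n : ℕ} (f : Fin 4 → Fin n) :
    ∃ r : Fin 4 → ℕ, StrictMono r ∧ (4 ≤ n → ∀ t, r t < n) ∧ ∀ a, ∃ t, r t = f a := by
  obtain hn | hn := le_or_gt 4 n
  · obtain ⟨A, hA, -, hc⟩ := Finset.exists_subsuperset_card_eq (Finset.subset_univ (univ.image f))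
      (n := 4) (Finset.card_image_le.trans (by simp)) (by simpa using hn)
    obtain ⟨r, hr, -, e, rfl⟩ := exists_strictMono_of_image A hc f (fun a => hA (by simp))
    exact ⟨fun t => r t, fun a b h => mem_strictMonos.1 hr h, fun _ t => (r t).2,
      fun a => ⟨e a, rfl⟩⟩
  -- With fewer than four rows, the numbers 0, 1, 2, 3 cover them all.
  · exact ⟨fun t => t, fun a b h => h, fun h => absurd h (by lia),
      fun a => ⟨⟨f a, (f a).2.trans hn⟩, rfl⟩⟩

lemma cycle_over_pattern {a : (Fin nc × F2 ℓ) ⊕ (Fin nv × F2 ℓ)}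
    (p : (tannerGraph (parityCheck x)).Walk a a) (hp : p.IsCycle) (hl : p.length = 8) :
    (∃ r : Fin 4 → ℕ, StrictMono r ∧ (4 ≤ nc → ∀ t, r t < nc) ∧
      ∀ (g : Fin nc) (y : F2 ℓ), Sum.inl (g, y) ∈ p.support → ∃ t, r t = g) ∧
    ∀ r : Fin 4 → ℕ, StrictMono r →
      (∀ (g : Fin nc) (y : F2 ℓ), Sum.inl (g, y) ∈ p.support → ∃ t, r t = g) →
      ∃ (m : Fin 21) (s : Fin 4 → Fin nc) (u v v' u' : Fin nv) (α : F2 ℓ),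
        IsPatternRows m r s ∧ (u, v, α) ∈ A₁ x s ∧ (u', v', α) ∈ A₂ x s ∧ u ≠ u' ∧ v ≠ v' ∧
        ClosedEquiv (p.map (projection x)) (rowColWalk s ![u, v, v', u']) := by
  obtain ⟨k, v, h, hk, hv, hr⟩ := exists_octWalk_of_isCycle p hp hl
  have hsupp : ∀ z, z ∈ p.support ↔ z ∈ (octWalk k v h).darts.map (·.snd) := fun z => by
    rw [← (hr.map _).mem_iff, SimpleGraph.Walk.map_snd_darts]
    refine (SimpleGraph.Walk.mem_support_iff p).trans (or_iff_right_of_imp ?_)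
    rintro rfl
    exact p.end_mem_tail_support hp.not_nil
  constructor
  · obtain ⟨r, hr, hrn, hcov⟩ := exists_strictMono_cover (Prod.fst ∘ k)
    refine ⟨r, hr, hrn, fun g y hg => ?_⟩
    rw [hsupp] at hg
    have : ∃ t, k t = (g, y) := by
      simp [octWalk] at hg
      obtain hg | hg | hg | hg := hg
      exacts [⟨_, hg.symm⟩, ⟨_, hg.symm⟩, ⟨_, hg.symm⟩, ⟨_, hg.symm⟩]
    obtain ⟨t, ht⟩ := this
    simpa [ht] using hcov t
  · intro r hrm hcov
    have : ∀ t, ∃ t', r t' = (k t).1 := fun t => by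
      refine hcov (k t).1 (k t).2 ((hsupp _).2 ?_)
      fin_cases t <;> simp [octWalk]
    choose w hw using this
    have hP := proper_fst_iff h
    have hks := hP.1.2 (.of_injective hk)
    obtain ⟨m, e, hme⟩ := exists_pattern w
      (fun t e => hks t (Fin.ext ((hw t).symm.trans ((congrArg r e).trans (hw _)))))
    have he := h.comp e
    have hc : (Prod.fst ∘ v) ∘ colIdx e ∈ liftCols x ((Prod.fst ∘ k) ∘ rowIdx e) :=
      Finset.mem_filter.2 ⟨mem_univ _, proper_comp_colIdx (hP.2.2 (.of_injective hv)) e,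
        (eq_lift_of_isOctagon he).1⟩
    obtain ⟨α, h1, h2, h3, h4⟩ := (mem_liftCols x _).1 hc
    refine ⟨m, (Prod.fst ∘ k) ∘ rowIdx e, _, _, _, _, α, ⟨hrm, fun t => ?_⟩, h1, h2, h3, h4, ?_⟩
    · rw [← hme]
      exact (hw _).symm
    · have hr' := hr.map (projection x).mapDart
      rw [← SimpleGraph.Walk.darts_map, ← SimpleGraph.Walk.darts_map,
        projection_octWalk h rfl rfl] at hr'
      rw [← comp_four, show ![(0 : Fin 4), 1, 2, 3] = id by decide, Function.comp_id]
      exact (closedEquiv_comp (isOctagon_protograph (Prod.fst ∘ k) (Prod.fst ∘ v)) e).imp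
        hr'.trans hr'.trans

lemma isTBC_rowColWalk {s : Fin 4 → Fin nc} {c : Fin 4 → Fin nv} (hs : Proper s) (hc : Proper c) :
    IsTBC (rowColWalk s c) := by
  simp only [Proper, Fin.forall_fin_succ] at hs hc
  simp at hs hc
  simp [IsTBC, rowColWalk, hs, hc]

lemma repetition_lifts (hg : (8 : ℕ∞) < 2 * (tannerGraph (parityCheck x)).egirth)
    {s : Fin 4 → Fin nc} (hs : Proper s) {u v u' v' : Fin nv} {α : F2 ℓ}
    (h₁ : (u, v, α) ∈ A₁ x s) (h₂ : (u', v', α) ∈ A₂ x s) (hu : u ≠ u') (hv : v ≠ v') :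
    IsTBC (rowColWalk s ![u, v, v', u']) ∧
    (∀ y : F2 ℓ, ∃ p : (tannerGraph (parityCheck x)).Walk (Sum.inl (s 0, y)) (Sum.inl (s 0, y)),
      p.IsCycle ∧ p.length = 8 ∧ p.map (projection x) = rowColWalk s ![u, v, v', u']) ∧
    (eightCyclesOver x (rowColWalk s ![u, v, v', u'])).ncard *
      (if s 0 = s 2 ∧ s 1 = s 3 ∧ u = v' ∧ v = u' then 2 else 1) = 2 ^ ℓ := by
  have hc : ![u, v, v', u'] ∈ liftCols x s := (mem_liftCols x s).2 ⟨α, h₁, h₂, hu, hv⟩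
  refine ⟨isTBC_rowColWalk hs (Finset.mem_filter.1 hc).2.1, fun y => ?_,
    ncard_eightCyclesOver hg hs hc⟩
  obtain ⟨h, hk, hv⟩ := lift_injective hg hs hc y
  exact ⟨octWalk _ _ h, octWalk_isCycle h hk hv, rfl, rfl⟩

lemma sum_patternTerm (hg : (8 : ℕ∞) < 2 * (tannerGraph (parityCheck x)).egirth) (hn : 4 ≤ nc) :
    (numEightCycles x : ℚ) = ∑ r ∈ strictMonos 4 nc, ∑ m : Fin 21,
      patternTerm x m (r ∘ pattern m) / (nc - numRows m).choose (4 - numRows m) := by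
  have h2 := sum_strictMonos_comp (n := nc) 4 (by norm_num : 2 ≤ 4) fun r =>
    2 ^ ℓ / 4 * (numRep x (r ∘ ![0, 1, 0, 1]) : ℚ)
  have h3 := sum_strictMonos_comp (n := nc) 4 (by norm_num : 3 ≤ 4) fun r =>
    2 ^ ℓ / 2 * ((numRep x (r ∘ ![0, 1, 0, 2]) : ℚ) +
        numRep x (r ∘ ![0, 2, 1, 2]) + numRep x (r ∘ ![0, 1, 2, 1]))
  have c2 : ((nc - 2).choose (4 - 2) : ℚ) ≠ 0 := by
    exact_mod_cast (Nat.choose_pos (by lia)).ne'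
  have c3 : ((nc - 3).choose (4 - 3) : ℚ) ≠ 0 := by
    exact_mod_cast (Nat.choose_pos (by lia)).ne'
  -- The binomial factors are inserted to spread the sums over quadruples. The six increasing pairs
  -- and four increasing triples in `Fin 4` then produce the six two-row and twelve three-row
  -- patterns.
  rw [numEightCycles_eq x hg, ← mul_div_cancel_left₀ (∑ r ∈ strictMonos 2 nc, _) c2, ← h2,
    ← mul_div_cancel_left₀ (∑ r ∈ strictMonos 3 nc, _) c3, ← h3, Finset.sum_div, Finset.sum_div,
    ← Finset.sum_add_distrib, ← Finset.sum_add_distrib]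
  refine Finset.sum_congr rfl fun r _ => ?_
  have hrows : numRows = ![2, 3, 3, 2, 3, 2, 3, 4, 3, 3, 4, 3, 3, 4, 3, 2, 3, 2, 3, 3, 2] := by
    decide +kernel
  rw [strictMonos_two_four, strictMonos_three_four]
  repeat rw [Finset.sum_insert (by decide +kernel)]
  simp only [Finset.sum_singleton, hrows, Fin.sum_univ_succ, patternTerm, pattern]
  simp [comp_four, starCount_eq]
  ring

end Patterns

end QuasiDyadic

open QuasiDyadic in
theorem mainTheorem4 (ℓ nc nv : ℕ) (x : Fin nc → Fin nv → F2 ℓ) :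
    -- the 21 patterns are pairwise nonequivalent, whatever the columns
    (∀ (r : Fin 4 → ℕ) (m m' : Fin 21) (s s' : Fin 4 → Fin nc) (c c' : Fin 4 → Fin nv),
      IsPatternRows m r s → IsPatternRows m' r s' →
      ClosedEquiv (rowColWalk s c) (rowColWalk s' c') → m = m') ∧
    -- every 8-cycle lies over some `h < i < j < k`, and for every choice of these rows that
    -- covers it, it projects onto one of the patterns, at columns given by a repetition
    (∀ (a : (Fin nc × F2 ℓ) ⊕ (Fin nv × F2 ℓ)) (p : (tannerGraph (parityCheck x)).Walk a a),
      p.IsCycle → p.length = 8 →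
      (∃ r : Fin 4 → ℕ, StrictMono r ∧ (4 ≤ nc → ∀ t, r t < nc) ∧
        ∀ (g : Fin nc) (y : F2 ℓ), Sum.inl (g, y) ∈ p.support → ∃ t, r t = g) ∧
      ∀ r : Fin 4 → ℕ, StrictMono r →
        (∀ (g : Fin nc) (y : F2 ℓ), Sum.inl (g, y) ∈ p.support → ∃ t, r t = g) →
        ∃ (m : Fin 21) (s : Fin 4 → Fin nc) (u v v' u' : Fin nv) (α : F2 ℓ),
          IsPatternRows m r s ∧ (u, v, α) ∈ A₁ x s ∧ (u', v', α) ∈ A₂ x s ∧ u ≠ u' ∧ v ≠ v' ∧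
          ClosedEquiv (p.map (projection x)) (rowColWalk s ![u, v, v', u'])) ∧
    -- the remaining claims concern Tanner graphs of girth `g` with `8 < 2 g`
    ((8 : ℕ∞) < 2 * (tannerGraph (parityCheck x)).egirth →
      -- every repetition gives a TBC walk, which lifts to 8-cycles only
      (∀ (r : Fin 4 → ℕ) (m : Fin 21) (s : Fin 4 → Fin nc) (u v u' v' : Fin nv) (α : F2 ℓ),
        IsPatternRows m r s → (u, v, α) ∈ A₁ x s → (u', v', α) ∈ A₂ x s → u ≠ u' → v ≠ v' →
        IsTBC (rowColWalk s ![u, v, v', u']) ∧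
        (∀ y : F2 ℓ, ∃ p : (tannerGraph (parityCheck x)).Walk (Sum.inl (s 0, y))
            (Sum.inl (s 0, y)),
          p.IsCycle ∧ p.length = 8 ∧ p.map (projection x) = rowColWalk s ![u, v, v', u']) ∧
        (eightCyclesOver x (rowColWalk s ![u, v, v', u'])).ncard *
          (if s 0 = s 2 ∧ s 1 = s 3 ∧ u = v' ∧ v = u' then 2 else 1) = 2 ^ ℓ) ∧
      -- the number of 8-cycles, every nonequivalent pattern being counted once
      (numEightCycles x : ℚ) =
        (∑ r : Fin 2 → Fin nc with r 0 < r 1, starCount x ![r 0, r 1, r 0, r 1]) +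
        (∑ r : Fin 3 → Fin nc with r 0 < r 1 ∧ r 1 < r 2,
          2 ^ ℓ / 2 * ((numRep x ![r 0, r 1, r 0, r 2] : ℚ) + numRep x ![r 0, r 2, r 1, r 2] +
            numRep x ![r 0, r 1, r 2, r 1])) +
        (∑ r : Fin 4 → Fin nc with r 0 < r 1 ∧ r 1 < r 2 ∧ r 2 < r 3,
          2 ^ ℓ * ((numRep x ![r 0, r 2, r 1, r 3] : ℚ) + numRep x ![r 0, r 1, r 2, r 3] +
            numRep x ![r 0, r 1, r 3, r 2])) ∧
      -- the same number as a sum of the 21 terms over all `h < i < j < k`; the denominator is the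
      -- number of quadruples in which the rows of the pattern occur, and is 1 for `nc = 4`
      (4 ≤ nc → (numEightCycles x : ℚ) =
        ∑ r : Fin 4 → Fin nc with r 0 < r 1 ∧ r 1 < r 2 ∧ r 2 < r 3, ∑ m : Fin 21,
          patternTerm x m (r ∘ pattern m) / (nc - numRows m).choose (4 - numRows m))) := by
  refine ⟨fun r m m' s s' c c' h h' he => patterns_nonequivalent h h' he,
    fun a p hp hl => cycle_over_pattern p hp hl, fun hg => ⟨?_, ?_, fun hn => ?_⟩⟩
  · intro r m s u v u' v' α hm h₁ h₂ hu hv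
    exact repetition_lifts hg hm.proper h₁ h₂ hu hv
  · rw [numEightCycles_eq x hg, strictMonos_two, strictMonos_three, strictMonos_four]
    simp only [comp_four, starCount_eq]
  · rw [sum_patternTerm hg hn, strictMonos_four]
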